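/- Let $U,W,V$ be complex vector spaces of dimensions $3,3,4$, with orientations $\Lambda^3U\cong\mathbb C$ and $\Lambda^3W\cong\mathbb C$, and let $B\in U^\vee\otimes W\otimes V^\vee$. Contraction of $B$ gives linear maps $g_{U^\vee}\colon U\to W\otimes V^\vee$ and $g_{V^\vee}\colon V\to U^\vee\otimes W=\operatorname{Hom}(U,W)$. Let $G^*\subset\mathbb P(V)=(\mathbb P^3)^\vee$ (lines in $V$) be the zero locus of the cubic form $v\mapsto\det g_{V^\vee}(v)$. Let $\neg B\colon\Lambda^2(W^\vee)\otimes V\to U^\vee\otimes W^\vee$ be the contraction with $B$, that is, $(\alpha\wedge\beta)\otimes v\mapsto(\alpha\circ g_{V^\vee}(v))\otimes\beta-(\beta\circ g_{V^\vee}(v))\otimes\alpha$, and let $U'\subset W\otimes V$ be the image of $\ker(\neg B)$ under the isomorphism $\Lambda^2(W^\vee)\cong W$ given by the orientation of $W$. Let $B'\in U'^\vee\otimes W\otimes V$ be the tensor of the inclusion $U'\subset W\otimes V$. The cross-product involution $(U,W,V^\vee,B)\mapsto(U',W,V,B')$ is defined at $B$ if $\neg B$ is surjective (and at $B'$ if the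 same holds for $B'$, with $V$ replaced by $V^\vee$). Let $K\subset S^2V$ be the kernel of the composition of $S^2(g_{V^\vee})\colon S^2V\to S^2(U^\vee\otimes W)$ with the projection of $S^2(U^\vee\otimes W)=(\Lambda^2U^\vee\otimes\Lambda^2W)\oplus(S^2U^\vee\otimes S^2W)$ onto its first summand. For $Q\in S^2V$ let $q\colon V^\vee\to V$, $\xi\mapsto(\xi\otimes\mathrm{id})(Q)$, be the corresponding linear map. **Proposition.** Suppose that the cubic surface $G^*$ is smooth. Then: 1. The cross-product involution is defined at $B$ and at $B'$, that is, $\neg B$ is surjective, $\dim U'=3$, and $\neg B'$ is surjective. 2. $\dim K=1$. Hence there is a Schur quadric of $B$, a generator $Q$ of $K$, and it is unique up to a scalar factor. 3. For every generator $Q$ of $K$ the map $q$ is an isomorphism, and $(\mathrm{id}_W\otimes q)(g_{U^\vee}(U))=U'$ as subspaces of $W\otimes V$. 4. In particular $B'$ is determined by $B$ and $Q$: the map $(\mathrm{id}_W\otimes q)\circ g_{U^\vee}$ is an isomorphism $e$ of $U$ onto $U'$, and $B'=\bigl((e^{-1})^\vee\otimes\mathrm{id}_W\otimes q\bigr)(B)$.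 -/

import Mathlib

open scoped TensorProduct

noncomputable section

namespace TriTensor

variable {U W V : Type*} [AddCommGroup U] [Module ℂ U] [AddCommGroup W] [Module ℂ W]
  [AddCommGroup V] [Module ℂ V]

/-- The bilinear wedge product as a linear map `M ⊗ M → Λ² M`, `a ⊗ b ↦ a ∧ b`. -/
def wedge (M : Type*) [AddCommGroup M] [Module ℂ M] : M ⊗[ℂ] M →ₗ[ℂ] ⋀[ℂ]^2 M :=
  TensorProduct.lift <| LinearMap.mk₂ ℂ (fun a b => exteriorPower.ιMulti ℂ 2 ![a, b])
    (fun a a' b => (exteriorPower.ιMulti ℂ 2 (M := M)).map_vecCons_add ![b] a a')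
    (fun c a b => (exteriorPower.ιMulti ℂ 2 (M := M)).map_vecCons_smul ![b] c a)
    (fun a b b' =>
      ((exteriorPower.ιMulti ℂ 2 (M := M)).curryLeft a).map_vecCons_add ![] b b')
    (fun c a b =>
      ((exteriorPower.ιMulti ℂ 2 (M := M)).curryLeft a).map_vecCons_smul ![] c b)

/-- The natural inclusion `Λ² M → M ⊗ M`, `a ∧ b ↦ a ⊗ b - b ⊗ a`. -/
def wedgeIncl (M : Type*) [AddCommGroup M] [Module ℂ M] : ⋀[ℂ]^2 M →ₗ[ℂ] M ⊗[ℂ] M :=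
  exteriorPower.alternatingMapLinearEquiv
    { toFun := fun x => x 0 ⊗ₜ[ℂ] x 1 - x 1 ⊗ₜ[ℂ] x 0
      map_update_add' := by
        intro _ m i x y
        fin_cases i <;>
          simp [Function.update, TensorProduct.add_tmul, TensorProduct.tmul_add] <;> abel
      map_update_smul' := by
        intro _ m i c x
        fin_cases i <;>
          simp [Function.update, TensorProduct.smul_tmul', TensorProduct.tmul_smul, smul_sub]
      map_eq_zero_of_eq' := by
        intro v i j hv hij
        fin_cases i <;> fin_cases j <;> simp_all }

/-! ### The linear maps attached to a tensor `B ∈ U^∨ ⊗ W ⊗ V^∨` -/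

/-- `g_{U^∨} : U → W ⊗ V^∨`, contraction of `B` in its first factor. -/
def gU (B : Module.Dual ℂ U ⊗[ℂ] W ⊗[ℂ] Module.Dual ℂ V) :
    U →ₗ[ℂ] W ⊗[ℂ] Module.Dual ℂ V :=
  dualTensorHom ℂ U (W ⊗[ℂ] Module.Dual ℂ V)
    (TensorProduct.assoc ℂ (Module.Dual ℂ U) W (Module.Dual ℂ V) B)

/-- `g_{V^∨} : V → U^∨ ⊗ W`, contraction of `B` in its third factor. -/
def gV (B : Module.Dual ℂ U ⊗[ℂ] W ⊗[ℂ] Module.Dual ℂ V) :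
    V →ₗ[ℂ] Module.Dual ℂ U ⊗[ℂ] W :=
  dualTensorHom ℂ V (Module.Dual ℂ U ⊗[ℂ] W)
    (TensorProduct.comm ℂ (Module.Dual ℂ U ⊗[ℂ] W) (Module.Dual ℂ V) B)

/-- `g_{V^∨}` read as a linear family `V → Hom(U, W)`, that is, as a matrix of linear forms
on `V`. -/
def gHom (B : Module.Dual ℂ U ⊗[ℂ] W ⊗[ℂ] Module.Dual ℂ V) : V →ₗ[ℂ] (U →ₗ[ℂ] W) :=
  dualTensorHom ℂ U W ∘ₗ gV B

/-! ### The cubic surface `G^* ⊂ P(V)` -/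

/-- The cubic form `v ↦ det (B(v) : U → W)` on `V`; the determinant is the scalar by which
`Λ³ B(v) : Λ³ U → Λ³ W` acts once both lines are identified with `ℂ` by orientations. -/
def detCubic (volU : ⋀[ℂ]^3 U ≃ₗ[ℂ] ℂ) (volW : ⋀[ℂ]^3 W ≃ₗ[ℂ] ℂ)
    (B : Module.Dual ℂ U ⊗[ℂ] W ⊗[ℂ] Module.Dual ℂ V) (v : V) : ℂ :=
  volW (exteriorPower.map 3 (gHom B v) (volU.symm 1))

/-- The hypersurface `{F = 0}` in the projective space of lines in `V` is smooth (`F` a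
homogeneous polynomial function): at each zero `v ≠ 0` some directional derivative of `F` is
nonzero. In particular `F` is not identically zero when `V ≠ 0`. -/
def IsSmoothHypersurface (F : V → ℂ) : Prop :=
  ∀ v : V, v ≠ 0 → F v = 0 → ∃ x : V, deriv (fun t : ℂ => F (v + t • x)) 0 ≠ 0

/-! ### The cross-product involution -/

/-- The contraction with `B`, `Λ²(W^∨) ⊗ V → U^∨ ⊗ W^∨`,
`(α ∧ β) ⊗ v ↦ (α ∘ B(v)) ⊗ β - (β ∘ B(v)) ⊗ α`. -/
def contraction (B : Module.Dual ℂ U ⊗[ℂ] W ⊗[ℂ] Module.Dual ℂ V) :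
    ⋀[ℂ]^2 (Module.Dual ℂ W) ⊗[ℂ] V →ₗ[ℂ] Module.Dual ℂ U ⊗[ℂ] Module.Dual ℂ W :=
  TensorProduct.lift <| LinearMap.mk₂ ℂ
    (fun θ v => LinearMap.rTensor (Module.Dual ℂ W) (gHom B v).dualMap
      (wedgeIncl (Module.Dual ℂ W) θ))
    (fun θ θ' v => by simp)
    (fun c θ v => by simp)
    (fun θ v v' => by
      have h : (gHom B (v + v')).dualMap = (gHom B v).dualMap + (gHom B v').dualMap := by
        ext; simp
      rw [h, LinearMap.rTensor_add, LinearMap.add_apply])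
    (fun c θ v => by
      have h : (gHom B (c • v)).dualMap = c • (gHom B v).dualMap := by
        ext; simp
      rw [h, LinearMap.rTensor_smul, LinearMap.smul_apply])

/-- The main assumption, under which the cross-product involution is defined at `B`. -/
def MainAssumption (B : Module.Dual ℂ U ⊗[ℂ] W ⊗[ℂ] Module.Dual ℂ V) : Prop :=
  Function.Surjective (contraction B)

/-- The map `W → (Λ² W)^∨`, `w ↦ (x ∧ y ↦ vol (w ∧ x ∧ y))`, given by an orientation of `W`;
it is an isomorphism if `dim W = 3`. -/
def orientDual (volW : ⋀[ℂ]^3 W ≃ₗ[ℂ] ℂ) : W →ₗ[ℂ] Module.Dual ℂ (⋀[ℂ]^2 W) :=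
  exteriorPower.alternatingMapLinearEquiv.toLinearMap ∘ₗ
    ((volW : ⋀[ℂ]^3 W →ₗ[ℂ] ℂ).compAlternatingMap (exteriorPower.ιMulti ℂ 3)).curryLeft

/-- The space `U' = ker (Λ²(W^∨) ⊗ V → U^∨ ⊗ W^∨)`, as a subspace of `W ⊗ V` through the
identifications `Λ²(W^∨) ≅ (Λ² W)^∨` (the determinant pairing) and `W ≅ (Λ² W)^∨` (the
orientation). -/
def crossSpace (volW : ⋀[ℂ]^3 W ≃ₗ[ℂ] ℂ)
    (B : Module.Dual ℂ U ⊗[ℂ] W ⊗[ℂ] Module.Dual ℂ V) : Submodule ℂ (W ⊗[ℂ] V) :=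
  ((LinearMap.ker (contraction B)).map
    (LinearMap.rTensor V (exteriorPower.pairingDual ℂ W 2))).comap
    (LinearMap.rTensor V (orientDual volW))

/-- The tensor `B' ∈ U'^∨ ⊗ W ⊗ V` that corresponds to the inclusion `U' → W ⊗ V`. -/
def crossTensor [FiniteDimensional ℂ W] [FiniteDimensional ℂ V] (volW : ⋀[ℂ]^3 W ≃ₗ[ℂ] ℂ)
    (B : Module.Dual ℂ U ⊗[ℂ] W ⊗[ℂ] Module.Dual ℂ V) :
    Module.Dual ℂ (crossSpace volW B) ⊗[ℂ] W ⊗[ℂ] V :=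
  (TensorProduct.assoc ℂ (Module.Dual ℂ (crossSpace volW B)) W V).symm
    ((dualTensorHomEquiv ℂ (crossSpace volW B) (W ⊗[ℂ] V)).symm (crossSpace volW B).subtype)

/-- A tensor in `U^∨ ⊗ W ⊗ V` seen in `U^∨ ⊗ W ⊗ (V^∨)^∨`, so that the constructions above
apply to it with `V^∨` in the place of `V`. -/
def toBidual (C : Module.Dual ℂ U ⊗[ℂ] W ⊗[ℂ] V) :
    Module.Dual ℂ U ⊗[ℂ] W ⊗[ℂ] Module.Dual ℂ (Module.Dual ℂ V) :=
  LinearMap.lTensor (Module.Dual ℂ U ⊗[ℂ] W) (Module.Dual.eval ℂ V) C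

/-! ### The Schur quadric -/

/-- The composition of `g ⊗ g : V ⊗ V → (U^∨ ⊗ W) ⊗ (U^∨ ⊗ W)`, `g = g_{V^∨}`, with
`(a ⊗ w) ⊗ (a' ⊗ w') ↦ (a ∧ a') ⊗ (w ∧ w')`. On symmetric tensors the latter is, up to a nonzero
constant, the projection of `S²(U^∨ ⊗ W)` onto its direct summand `Λ² U^∨ ⊗ Λ² W`. -/
def schurMap (B : Module.Dual ℂ U ⊗[ℂ] W ⊗[ℂ] Module.Dual ℂ V) :
    V ⊗[ℂ] V →ₗ[ℂ] ⋀[ℂ]^2 (Module.Dual ℂ U) ⊗[ℂ] ⋀[ℂ]^2 W :=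
  TensorProduct.map (wedge (Module.Dual ℂ U)) (wedge W) ∘ₗ
    (TensorProduct.tensorTensorTensorComm ℂ (Module.Dual ℂ U) W
      (Module.Dual ℂ U) W).toLinearMap ∘ₗ
    TensorProduct.map (gV B) (gV B)

/-- The space `S² V`, realised as the space of symmetric tensors in `V ⊗ V`. -/
def symTensors (V : Type*) [AddCommGroup V] [Module ℂ V] : Submodule ℂ (V ⊗[ℂ] V) :=
  LinearMap.eqLocus (TensorProduct.comm ℂ V V).toLinearMap LinearMap.id

/-- The kernel of `S² V → Λ² U^∨ ⊗ Λ² W`. A Schur quadric of `B` is a generator of it. -/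
def schurKernel (B : Module.Dual ℂ U ⊗[ℂ] W ⊗[ℂ] Module.Dual ℂ V) : Submodule ℂ (V ⊗[ℂ] V) :=
  symTensors V ⊓ LinearMap.ker (schurMap B)

/-- The linear map `V^∨ → V` attached to `Q ∈ V ⊗ V`, `ξ ↦ (ξ ⊗ id) Q`. -/
def quadricMap (Q : V ⊗[ℂ] V) : Module.Dual ℂ V →ₗ[ℂ] V :=
  (TensorProduct.lid ℂ V).toLinearMap ∘ₗ LinearMap.applyₗ Q ∘ₗ LinearMap.rTensorHom V

end TriTensor

end

namespace TriTensor

open Module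

/-! ### Linear algebra over `ℂ` -/

/-! Write M for the family `gHom B`. Smoothness enters only through `IsNondegenerate`: M v has rank
at least two for v ≠ 0, and if u is in its kernel and α kills its image (u, α ≠ 0), then the
derivative x ↦ α(M x u) of the determinant is not zero.

By duality, the contraction fails to be surjective only if some N ≠ 0 from W^∨ to U makes every M v
∘ N symmetric (`mainAssumption_of_symmetric`). If N is invertible, these form a four-dimensional
system of symmetric 3 × 3 matrices. It is cut out by two equations, two conics have a common point,
and so the system contains a matrix of rank one, which is excluded. If N is singular, symmetry
forces a block of zeros in M, excluded by `row_block` and `col_block`.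

The kernel K has dimension at least 10 − 9. Its elements are apolar to the 2 × 2 minors of M, and
the core of the proof is that a nonzero apolar quadric is nondegenerate (`IsApolar.injective`).
Suppose that q is degenerate with range I. Some u₀ makes v ↦ M v u₀ injective on I. Read through
this map, the slices v ↦ M v u become commuting endomorphisms of I, and a common eigenvector v has M
v of rank at most one, a contradiction. Since every pencil of quadrics has a degenerate member, dim
K = 1.

Apolarity also says that id ⊗ q carries the image of U into U'; dimensions give equality. The slices
of B' are then those of B reparametrized by e and q, so surjectivity passes from B to B'. -/

/-- A subspace of dimension at least two contains two linearly independent vectors. -/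
theorem exists_pair_of_two_le_finrank {X : Type*} [AddCommGroup X] [Module ℂ X]
    (P : Submodule ℂ X) (h : 2 ≤ finrank ℂ P) :
    ∃ x ∈ P, ∃ y ∈ P, LinearIndependent ℂ ![x, y] := by
  have : Nontrivial P := nontrivial_of_finrank_pos (R := ℂ) (by omega)
  obtain ⟨x, hx⟩ := exists_ne (0 : P)
  obtain ⟨y, hy⟩ := exists_linearIndependent_pair_of_one_lt_finrank (by omega : 1 < finrank ℂ P) hx
  refine ⟨x, x.2, y, y.2, ?_⟩
  rw [LinearIndependent.pair_iff] at hy ⊢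
  intro s t hst
  exact hy s t (by ext; simpa using hst)

theorem two_le_finrank_of_pair {X : Type*} [AddCommGroup X] [Module ℂ X] [FiniteDimensional ℂ X]
    (P : Submodule ℂ X) {x y : X} (hx : x ∈ P) (hy : y ∈ P) (h : LinearIndependent ℂ ![x, y]) :
    2 ≤ finrank ℂ P := by
  have h1 : LinearIndependent ℂ ![(⟨x, hx⟩ : P), ⟨y, hy⟩] := by
    rw [LinearIndependent.pair_iff] at h ⊢
    intro s t hst
    exact h s t (by simpa using congrArg Subtype.val hst)
  simpa using h1.fintype_card_le_finrank

/-- A pencil of linear maps into a space of no larger dimension has a singular member. -/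
theorem exists_singular_in_pencil {P R : Type*} [AddCommGroup P] [Module ℂ P]
    [FiniteDimensional ℂ P] [AddCommGroup R] [Module ℂ R] [FiniteDimensional ℂ R]
    (hP : 0 < finrank ℂ P) (hPR : finrank ℂ R ≤ finrank ℂ P) (f g : P →ₗ[ℂ] R) :
    ∃ s t : ℂ, (s ≠ 0 ∨ t ≠ 0) ∧ ∃ p : P, p ≠ 0 ∧ s • f p + t • g p = 0 := by
  by_cases hf : Function.Injective f
  · have hd : finrank ℂ P = finrank ℂ R := le_antisymm (LinearMap.finrank_le_finrank_of_injective hf) hPR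
    let e := LinearEquiv.ofInjectiveOfFinrankEq f hf hd
    have : Nontrivial P := nontrivial_of_finrank_pos (R := ℂ) hP
    -- An eigenvector of f⁻¹ ∘ g with eigenvalue c is killed by c f − g.
    obtain ⟨c, hc⟩ := Module.End.exists_eigenvalue (e.symm.toLinearMap ∘ₗ g)
    obtain ⟨p, hp⟩ := hc.exists_hasEigenvector
    refine ⟨c, -1, Or.inr (by simp), p, hp.2, ?_⟩
    have h1 := congrArg e hp.apply_eq_smul
    simp only [LinearMap.comp_apply, LinearEquiv.coe_coe, LinearEquiv.apply_symm_apply,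
      map_smul] at h1
    have h2 : e p = f p := rfl
    rw [h1, h2]
    simp
  · rw [← LinearMap.ker_eq_bot, Submodule.eq_bot_iff] at hf
    push Not at hf
    obtain ⟨p, hp, hp0⟩ := hf
    exact ⟨1, 0, Or.inl one_ne_zero, p, hp0, by simpa using hp⟩

/-- A binary quadratic form over `ℂ` has a nontrivial zero. -/
theorem exists_isotropic_of_pair {X : Type*} [AddCommGroup X] [Module ℂ X]
    (q : X →ₗ[ℂ] X →ₗ[ℂ] ℂ) {x y : X} (h : LinearIndependent ℂ ![x, y]) :
    ∃ s t : ℂ, s • x + t • y ≠ 0 ∧ q (s • x + t • y) (s • x + t • y) = 0 := by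
  rw [LinearIndependent.pair_iff] at h
  by_cases hx : q x x = 0
  · refine ⟨1, 0, fun h0 => ?_, by simpa using hx⟩
    exact one_ne_zero (h _ _ h0).1
  · obtain ⟨s, hs⟩ := exists_quadratic_eq_zero (a := q x x) (b := q x y + q y x) (c := q y y) hx
      ((IsAlgClosed.exists_pow_nat_eq (discrim _ _ _) (n := 2) two_pos).imp
        fun z hz => by rw [← hz, sq])
    refine ⟨s, 1, fun h0 => one_ne_zero (h _ _ h0).2, ?_⟩
    simp only [one_smul, map_add, map_smul, LinearMap.add_apply, LinearMap.smul_apply, smul_eq_mul]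
    linear_combination hs

/-- Two plane conics over `ℂ` have a common point. -/
theorem exists_common_zero_of_conics {X : Type*} [AddCommGroup X] [Module ℂ X]
    [FiniteDimensional ℂ X] (hX : finrank ℂ X = 3) (q : Fin 2 → X →ₗ[ℂ] X →ₗ[ℂ] ℂ)
    (hq : ∀ i x y, q i x y = q i y x) :
    ∃ x, x ≠ 0 ∧ q 0 x x = 0 ∧ q 1 x x = 0 := by
  -- A singular conic in the pencil, with vertex p.
  obtain ⟨s, t, hst, p, hp, h⟩ := exists_singular_in_pencil (by omega)
    (by rw [Subspace.dual_finrank_eq (K := ℂ) (V := X)]) (q 0) (q 1)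
  have h' : ∀ x, s * q 0 p x + t * q 1 p x = 0 := fun x => by
    simpa using LinearMap.congr_fun h x
  obtain ⟨C, hC⟩ := Submodule.exists_isCompl (ℂ ∙ p)
  have hdim := Submodule.finrank_add_eq_of_isCompl hC
  rw [finrank_span_singleton hp, hX] at hdim
  obtain ⟨x, hx, y, hy, hxy⟩ := exists_pair_of_two_le_finrank C (by omega)
  obtain ⟨a, b, hz, hzz⟩ := exists_isotropic_of_pair (s • q 0 + t • q 1) hxy
  set z := a • x + b • y
  have hzC : z ∈ C := C.add_mem (C.smul_mem _ hx) (C.smul_mem _ hy)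
  have hpz : LinearIndependent ℂ ![p, z] := by
    rw [LinearIndependent.pair_iff' hp]
    intro c hc
    rw [← hc] at hzC
    exact hz (hc ▸ (Submodule.disjoint_def.1 hC.disjoint) _ (Submodule.smul_mem _ _
      (Submodule.mem_span_singleton_self p)) hzC)
  have hzz' : s * q 0 z z + t * q 1 z z = 0 := by simpa using hzz
  -- The singular conic contains the line through p and z. It remains to solve one other conic of
  -- the pencil on that line.
  have key : ∀ c d : ℂ, s * q 0 (c • p + d • z) (c • p + d • z)
      + t * q 1 (c • p + d • z) (c • p + d • z) = 0 := by
    intro c d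
    simp only [map_add, map_smul, LinearMap.add_apply, LinearMap.smul_apply, smul_eq_mul]
    rw [hq 0 z p, hq 1 z p]
    linear_combination c * c * h' p + 2 * c * d * h' z + d * d * hzz'
  rcases hst with hs | ht
  · obtain ⟨c, d, hne, h0⟩ := exists_isotropic_of_pair (q 1) hpz
    refine ⟨_, hne, ?_, h0⟩
    have := key c d
    rw [h0] at this
    simpa [hs] using this
  · obtain ⟨c, d, hne, h0⟩ := exists_isotropic_of_pair (q 0) hpz
    refine ⟨_, hne, h0, ?_⟩
    have := key c d
    rw [h0] at this
    simpa [ht] using this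

/-- A four-dimensional linear system of symmetric `3 × 3` matrices contains the square of a nonzero
vector. A symmetric matrix is given by its diagonal and its entries above the diagonal. -/
theorem exists_square_mem (R : Submodule ℂ (Fin 6 → ℂ)) (hR : finrank ℂ R = 4) :
    ∃ x : Fin 3 → ℂ, x ≠ 0 ∧
      ![x 0 * x 0, x 1 * x 1, x 2 * x 2, x 0 * x 1, x 0 * x 2, x 1 * x 2] ∈ R := by
  have hr : finrank ℂ ((Fin 6 → ℂ) ⧸ R) = 2 := by
    have h1 := R.finrank_quotient_add_finrank
    rw [hR, finrank_fin_fun] at h1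
    omega
  let c : Basis (Fin 2) ℂ ((Fin 6 → ℂ) ⧸ R) := finBasisOfFinrankEq ℂ _ hr
  obtain ⟨sq, hsq⟩ : ∃ sq : (Fin 3 → ℂ) →ₗ[ℂ] (Fin 3 → ℂ) →ₗ[ℂ] (Fin 6 → ℂ), ∀ x y, sq x y =
      ![x 0 * y 0, x 1 * y 1, x 2 * y 2, (x 0 * y 1 + x 1 * y 0) / 2,
        (x 0 * y 2 + x 2 * y 0) / 2, (x 1 * y 2 + x 2 * y 1) / 2] :=
    ⟨LinearMap.mk₂ ℂ (fun x y => ![x 0 * y 0, x 1 * y 1, x 2 * y 2, (x 0 * y 1 + x 1 * y 0) / 2,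
      (x 0 * y 2 + x 2 * y 0) / 2, (x 1 * y 2 + x 2 * y 1) / 2])
      (fun x x' y => by ext k; fin_cases k <;> simp <;> ring)
      (fun a x y => by ext k; fin_cases k <;> simp <;> ring)
      (fun x y y' => by ext k; fin_cases k <;> simp <;> ring)
      (fun a x y => by ext k; fin_cases k <;> simp <;> ring), fun _ _ => rfl⟩
  have hsymm : ∀ x y, sq x y = sq y x := by
    intro x y
    rw [hsq, hsq]
    simp only [mul_comm, add_comm]
  -- The two conics are the two linear equations of `R`, evaluated on squares.
  obtain ⟨x, hx, hx0, hx1⟩ := exists_common_zero_of_conics (X := Fin 3 → ℂ) (by simp)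
    (fun i => sq.compr₂ (c.coord i ∘ₗ R.mkQ))
    (fun i x y => by simp only [LinearMap.compr₂_apply, hsymm x y])
  refine ⟨x, hx, ?_⟩
  have hmem : sq x x ∈ R := by
    rw [← Submodule.Quotient.mk_eq_zero]
    apply c.ext_elem
    intro i
    rw [map_zero]
    fin_cases i
    · exact hx0
    · exact hx1
  convert hmem using 1
  rw [hsq]
  congr 1
  simp only [mul_comm (x 1) (x 0), mul_comm (x 2) (x 0), mul_comm (x 2) (x 1), add_self_div_two]

/-! ### Nondegenerate families of linear maps -/

variable {U W V : Type*} [AddCommGroup U] [Module ℂ U] [AddCommGroup W] [Module ℂ W]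
  [AddCommGroup V] [Module ℂ V]

/-- The conditions on a linear family `M : V → Hom(U, W)` of `3 × 3` matrices that smoothness of
the surface `det M = 0` amounts to. -/
structure IsNondegenerate (M : V →ₗ[ℂ] U →ₗ[ℂ] W) : Prop where
  ker_le : ∀ v, v ≠ 0 → ∀ u₁ u₂, M v u₁ = 0 → M v u₂ = 0 → ¬ LinearIndependent ℂ ![u₁, u₂]
  exists_ne : ∀ v, v ≠ 0 → ∀ u, u ≠ 0 → ∀ α : Dual ℂ W, α ≠ 0 → M v u = 0 →
    (∀ u', α (M v u') = 0) → ∃ x, α (M x u) ≠ 0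

namespace IsNondegenerate

variable {M : V →ₗ[ℂ] U →ₗ[ℂ] W}

theorem exists_notMem_span [FiniteDimensional ℂ U] (h : IsNondegenerate M) (hU : finrank ℂ U = 3) {v : V} (hv : v ≠ 0)
    (w : W) : ∃ u, M v u ∉ ℂ ∙ w := by
  by_contra! hc
  have h1 : LinearMap.range (M v) ≤ ℂ ∙ w := by
    rintro _ ⟨u, rfl⟩
    exact hc u
  have h2 := (Submodule.finrank_mono h1).trans (finrank_span_le_card ({w} : Set W))
  have h3 := (M v).finrank_range_add_finrank_ker
  simp only [Set.toFinset_singleton, Finset.card_singleton] at h2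
  obtain ⟨x, hx, y, hy, hxy⟩ := exists_pair_of_two_le_finrank (LinearMap.ker (M v)) (by omega)
  exact h.ker_le v hv x y hx hy hxy

/-- The transpose of a nondegenerate family is nondegenerate. -/
theorem transpose [FiniteDimensional ℂ U] [FiniteDimensional ℂ W]
    (h : IsNondegenerate M) (hU : finrank ℂ U = 3) (hW : finrank ℂ W = 3) :
    IsNondegenerate (Dual.transpose (R := ℂ) (M := U) (M' := W) ∘ₗ M) where
  ker_le v hv α β hα hβ hαβ := by
    have h1 := two_le_finrank_of_pair (LinearMap.ker (M v).dualMap) hα hβ hαβ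
    have h2 := (M v).dualMap.finrank_range_add_finrank_ker
    have h3 := (M v).finrank_range_add_finrank_ker
    rw [LinearMap.finrank_range_dualMap_eq_finrank_range, Subspace.dual_finrank_eq] at h2
    obtain ⟨x, hx, y, hy, hxy⟩ := exists_pair_of_two_le_finrank (LinearMap.ker (M v)) (by omega)
    exact h.ker_le v hv x y hx hy hxy
  exists_ne v hv α hα φ hφ h1 h2 := by
    obtain ⟨u, rfl⟩ := (evalEquiv ℂ U).surjective φ
    have hu : u ≠ 0 := by rintro rfl; simp at hφ
    refine h.exists_ne v hv u hu α hα ?_ fun u' => LinearMap.congr_fun h1 u'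
    exact (forall_dual_apply_eq_zero_iff ℂ _).1 fun β => h2 β

/-- A nondegenerate family has no `1 × 2` block of zeros. -/
theorem row_block [FiniteDimensional ℂ U] [FiniteDimensional ℂ W]
    [FiniteDimensional ℂ V] (h : IsNondegenerate M) (hU : finrank ℂ U = 3) (hW : finrank ℂ W = 3)
    (hV : finrank ℂ V = 4) {α : Dual ℂ W} (hα : α ≠ 0) (P : Submodule ℂ U) (hP : 2 ≤ finrank ℂ P) :
    ∃ u ∈ P, ∃ v, α (M v u) ≠ 0 := by
  by_contra! hc
  let A : V →ₗ[ℂ] Dual ℂ U := LinearMap.llcomp ℂ U W ℂ α ∘ₗ M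
  -- The covectors α ∘ M v lie in the annihilator of P, of dimension at most one, so they vanish for
  -- v in a space of dimension at least three. For such v, M v maps P into the plane ker α, and a
  -- pencil of such maps has a singular member.
  have hA : LinearMap.range A ≤ P.dualAnnihilator := by
    rintro _ ⟨v, rfl⟩
    rw [Submodule.mem_dualAnnihilator]
    exact fun u hu => hc u hu v
  have h1 := Submodule.finrank_mono hA
  have h2 := Subspace.finrank_add_finrank_dualAnnihilator_eq P
  have h3 := A.finrank_range_add_finrank_ker
  obtain ⟨v₁, hv₁, v₂, hv₂, hv⟩ := exists_pair_of_two_le_finrank (LinearMap.ker A) (by omega)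
  have h4 : finrank ℂ (LinearMap.ker α) = 2 := by
    have := α.finrank_range_add_finrank_ker
    rw [LinearMap.range_eq_top.2 (LinearMap.surjective hα), finrank_top, finrank_self] at this
    omega
  let f : V → P →ₗ[ℂ] LinearMap.ker α := fun v =>
    ((M v).comp P.subtype).codRestrict (LinearMap.ker α) fun u => hc u u.2 v
  obtain ⟨s, t, hst, p, hp, hpp⟩ := exists_singular_in_pencil (by omega) (by omega) (f v₁) (f v₂)
  have h5 : M (s • v₁ + t • v₂) p = 0 := by
    rw [map_add, map_smul, map_smul]
    exact congrArg Subtype.val hpp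
  have h6 : s • v₁ + t • v₂ ≠ 0 := by
    intro h0
    have := (LinearIndependent.pair_iff.1 hv) s t h0
    tauto
  have h7 : s • v₁ + t • v₂ ∈ LinearMap.ker A :=
    Submodule.add_mem _ (Submodule.smul_mem _ _ hv₁) (Submodule.smul_mem _ _ hv₂)
  -- Here p is in the kernel and α kills the image, so nondegeneracy requires some α(M x p) ≠ 0,
  -- against p ∈ P.
  obtain ⟨x, hx⟩ := h.exists_ne _ h6 p (by simpa using hp) α hα h5
    fun u' => LinearMap.congr_fun h7 u'
  exact hx (hc p p.2 x)

/-- A nondegenerate family has no `2 × 1` block of zeros. -/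
theorem col_block [FiniteDimensional ℂ U] [FiniteDimensional ℂ W]
    [FiniteDimensional ℂ V] (h : IsNondegenerate M) (hU : finrank ℂ U = 3) (hW : finrank ℂ W = 3)
    (hV : finrank ℂ V = 4) {u : U} (hu : u ≠ 0) (P : Submodule ℂ (Dual ℂ W))
    (hP : 2 ≤ finrank ℂ P) : ∃ α ∈ P, ∃ v, α (M v u) ≠ 0 :=
  (h.transpose hU hW).row_block (by rwa [Subspace.dual_finrank_eq])
    (by rwa [Subspace.dual_finrank_eq]) hV (α := evalEquiv ℂ U u) 
    (by simpa only [ne_eq, LinearEquiv.map_eq_zero_iff] using hu) P hP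

/-- No four-dimensional linear system of symmetric `3 × 3` matrices omits the matrices of
rank one. -/
theorem not_symmetric_of_bijective [FiniteDimensional ℂ U] [FiniteDimensional ℂ W]
    [FiniteDimensional ℂ V] (h : IsNondegenerate M) (hU : finrank ℂ U = 3)
    (hW : finrank ℂ W = 3) (hV : finrank ℂ V = 4) (N : Dual ℂ W →ₗ[ℂ] U)
    (hN : Function.Surjective N) (hs : ∀ v (α β : Dual ℂ W), α (M v (N β)) = β (M v (N α))) : False := by
  let b : Basis (Fin 3) ℂ W := finBasisOfFinrankEq ℂ W hW
  let m : Fin 3 → Fin 3 → V →ₗ[ℂ] ℂ := fun i j =>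
    b.coord i ∘ₗ M.flip (N (b.coord j))
  have hm : ∀ i j v, m i j v = m j i v := fun i j v =>
    hs v (b.coord i) (b.coord j)
  let L : V →ₗ[ℂ] (Fin 6 → ℂ) :=
    LinearMap.pi ![m 0 0, m 1 1, m 2 2, m 0 1, m 0 2, m 1 2]
  have hspan : ∀ (v : V) (w : W), (∀ j, M v (N (b.coord j)) ∈ ℂ ∙ w) → v = 0 := by
    intro v w hw
    by_contra hv
    obtain ⟨u, hu⟩ := h.exists_notMem_span hU hv w
    obtain ⟨α, rfl⟩ := hN u
    apply hu
    rw [← b.dualBasis.sum_repr α]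
    simp only [map_sum, map_smul, Basis.coe_dualBasis]
    exact Submodule.sum_mem _ fun j _ => Submodule.smul_mem _ _ (hw j)
  have hrec : ∀ v j, M v (N (b.coord j)) = ∑ i, m i j v • b i := fun v j =>
    (b.sum_repr _).symm
  have hLinj : LinearMap.ker L = ⊥ := by
    rw [Submodule.eq_bot_iff]
    intro v hv
    have h0 : ∀ k, L v k = 0 := fun k => congrFun hv k
    have e0 : m 0 0 v = 0 := h0 0
    have e1 : m 1 1 v = 0 := h0 1
    have e2 : m 2 2 v = 0 := h0 2
    have e3 : m 0 1 v = 0 := h0 3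
    have e4 : m 0 2 v = 0 := h0 4
    have e5 : m 1 2 v = 0 := h0 5
    apply hspan v 0
    intro j
    rw [hrec]
    fin_cases j <;>
      simp [Fin.sum_univ_three, e0, e1, e2, e3, e4, e5, hm 1 0, hm 2 0, hm 2 1]
  -- The matrix x xᵀ in the system has all its columns on one line, so `hspan` forces v = 0 and then
  -- x = 0.
  obtain ⟨x, hx, v, hv⟩ := exists_square_mem (LinearMap.range L)
    (by rw [LinearMap.finrank_range_of_inj (LinearMap.ker_eq_bot.1 hLinj), hV])
  have e0 : m 0 0 v = x 0 * x 0 := congrFun hv 0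
  have e1 : m 1 1 v = x 1 * x 1 := congrFun hv 1
  have e2 : m 2 2 v = x 2 * x 2 := congrFun hv 2
  have e3 : m 0 1 v = x 0 * x 1 := congrFun hv 3
  have e4 : m 0 2 v = x 0 * x 2 := congrFun hv 4
  have e5 : m 1 2 v = x 1 * x 2 := congrFun hv 5
  have hv0 : v = 0 := by
    apply hspan v (∑ i, x i • b i)
    intro j
    rw [Submodule.mem_span_singleton]
    refine ⟨x j, ?_⟩
    rw [hrec, Finset.smul_sum]
    refine Finset.sum_congr rfl fun i _ => ?_
    rw [smul_smul]
    congr 1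
    fin_cases i <;> fin_cases j <;>
      simp [e0, e1, e2, e3, e4, e5, hm 1 0, hm 2 0, hm 2 1, mul_comm (x 1) (x 0),
        mul_comm (x 2) (x 0), mul_comm (x 2) (x 1)]
  apply hx
  rw [hv0] at e0 e1 e2
  ext k
  fin_cases k
  · simpa using e0
  · simpa using e1
  · simpa using e2

/-- If all `M v ∘ N` are symmetric, then `N = 0`. -/
theorem eq_zero_of_symmetric [FiniteDimensional ℂ U] [FiniteDimensional ℂ W]
    [FiniteDimensional ℂ V] (h : IsNondegenerate M) (hU : finrank ℂ U = 3)
    (hW : finrank ℂ W = 3) (hV : finrank ℂ V = 4) (N : Dual ℂ W →ₗ[ℂ] U)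
    (hs : ∀ v (α β : Dual ℂ W), α (M v (N β)) = β (M v (N α))) : N = 0 := by
  have hd : finrank ℂ (Dual ℂ W) = finrank ℂ U := by rw [Subspace.dual_finrank_eq, hU, hW]
  by_contra hN
  by_cases hi : Function.Injective N
  · exact h.not_symmetric_of_bijective hU hW hV N
      ((LinearMap.injective_iff_surjective_of_finrank_eq_finrank hd).1 hi) hs
  rw [← LinearMap.ker_eq_bot, Submodule.eq_bot_iff] at hi
  push Not at hi
  obtain ⟨α, hα, hα0⟩ := hi
  -- Symmetry gives α(M v (N β)) = β(M v (N α)) = 0, so α is zero against the range of N. If that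
  -- range is a line, the kernel of N has dimension at least two and gives a block in the column N
  -- β.
  by_cases hr : 2 ≤ finrank ℂ (LinearMap.range N)
  · obtain ⟨_, ⟨β, rfl⟩, v, hv⟩ := h.row_block hU hW hV hα0 _ hr
    rw [hs, LinearMap.mem_ker.1 hα] at hv
    simp at hv
  · obtain ⟨β, hβ⟩ : ∃ β, N β ≠ 0 := by
      by_contra! hc
      exact hN (LinearMap.ext hc)
    have h1 := N.finrank_range_add_finrank_ker
    obtain ⟨γ, hγ, v, hv⟩ := h.col_block hU hW hV hβ (LinearMap.ker N) (by omega)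
    rw [hs, LinearMap.mem_ker.1 hγ] at hv
    simp at hv

end IsNondegenerate

/-! ### Apolar quadrics -/

/-- A finite commuting family of endomorphisms has a common eigenvector. -/
theorem exists_common_eigenvector (n : ℕ) : ∀ {X : Type*} [AddCommGroup X] [Module ℂ X]
    [FiniteDimensional ℂ X] [Nontrivial X] (f : Fin n → End ℂ X),
    (∀ i j, Commute (f i) (f j)) → ∃ x ≠ 0, ∃ c : Fin n → ℂ, ∀ i, f i x = c i • x := by
  induction n with
  | zero =>
    intro X _ _ _ _ f _
    obtain ⟨x, hx⟩ := exists_ne (0 : X)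
    exact ⟨x, hx, Fin.elim0, fun i => i.elim0⟩
  | succ n ih =>
    intro X _ _ _ _ f hf
    obtain ⟨μ, hμ⟩ := End.exists_eigenvalue (f 0)
    have hE : Nontrivial ((f 0).eigenspace μ) := (Submodule.nontrivial_iff_ne_bot).2 hμ
    have hmap : ∀ i : Fin n, ∀ x ∈ (f 0).eigenspace μ, f i.succ x ∈ (f 0).eigenspace μ :=
      fun i x hx => by
        rw [End.mem_eigenspace_iff] at hx ⊢
        rw [← Module.End.mul_apply, (hf 0 i.succ).eq, Module.End.mul_apply, hx, map_smul]
    obtain ⟨x, hx, c, hc⟩ := ih (fun i => (f i.succ).restrict (hmap i)) fun i j => by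
      refine LinearMap.ext fun x => Subtype.ext ?_
      exact LinearMap.congr_fun (hf i.succ j.succ) x
    refine ⟨x, by simpa using hx, Fin.cons μ c, Fin.cases ?_ fun i => ?_⟩
    · exact End.mem_eigenspace_iff.1 x.2
    · exact congrArg Subtype.val (hc i)

/-- A symmetric map `q : V^∨ → V` is apolar to the family `M` if, as a bilinear form on `V^∨`, it
vanishes on all `2 × 2` minors of the matrix of linear forms `M`. -/
structure IsApolar (M : V →ₗ[ℂ] U →ₗ[ℂ] W) (q : Dual ℂ V →ₗ[ℂ] V) : Prop where
  symm : ∀ ξ η : Dual ℂ V, η (q ξ) = ξ (q η)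
  minor : ∀ (α β : Dual ℂ W) (u u' : U),
    β (M (q (α ∘ₗ M.flip u)) u') = α (M (q (β ∘ₗ M.flip u)) u')

namespace IsApolar

variable {M : V →ₗ[ℂ] U →ₗ[ℂ] W} {q : Dual ℂ V →ₗ[ℂ] V}

/-- Pair with any β: `minor` exchanges α and β, and the symmetry of `q` exchanges them back while
exchanging u and u'. -/
theorem apply_comm (h : IsApolar M q) (α : Dual ℂ W) (u u' : U) :
    M (q (α ∘ₗ M.flip u)) u' = M (q (α ∘ₗ M.flip u')) u := by
  refine eq_of_sub_eq_zero ((forall_dual_apply_eq_zero_iff ℂ _).1 fun β => ?_)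
  rw [map_sub, sub_eq_zero, h.minor α β u u']
  exact h.symm (β ∘ₗ M.flip u) (α ∘ₗ M.flip u')

/-- If `u₀` is killed by no nonzero `M v` with `v` in the range of `q`, then some such `M v` has
rank at most one. -/
theorem exists_rank_le_one [FiniteDimensional ℂ U] [FiniteDimensional ℂ V] (h : IsApolar M q)
    (hq : q ≠ 0) (hU : finrank ℂ U = 3)
    (u₀ : U) (hu₀ : ∀ v ∈ LinearMap.range q, M v u₀ = 0 → v = 0) :
    ∃ v ≠ 0, ∀ u, M v u ∈ ℂ ∙ M v u₀ := by
  let X₀ : LinearMap.range q →ₗ[ℂ] W := M.flip u₀ ∘ₗ (LinearMap.range q).subtype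
  have hX₀ : LinearMap.ker X₀ = ⊥ := by
    rw [Submodule.eq_bot_iff]
    rintro ⟨v, hv⟩ hv0
    exact Subtype.ext (hu₀ v hv hv0)
  let p : U → Dual ℂ W →ₗ[ℂ] LinearMap.range q := fun u =>
    q.rangeRestrict ∘ₗ (M.flip u).dualMap
  -- Since X₀ is injective, every form on the range of q is α ∘ X₀ for some α, and by symmetry q ξ
  -- depends only on the restriction of ξ to that range.
  have hp : LinearMap.range (p u₀) = ⊤ := by
    rw [LinearMap.range_eq_top]
    rintro ⟨_, ξ, rfl⟩
    obtain ⟨g, hg⟩ := LinearMap.exists_leftInverse_of_injective X₀ hX₀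
    refine ⟨ξ ∘ₗ (LinearMap.range q).subtype ∘ₗ g, Subtype.ext ?_⟩
    change q ((ξ ∘ₗ (LinearMap.range q).subtype ∘ₗ g) ∘ₗ M.flip u₀) = q ξ
    refine eq_of_sub_eq_zero ((forall_dual_apply_eq_zero_iff ℂ _).1 fun η => ?_)
    rw [map_sub, sub_eq_zero, h.symm, h.symm ξ η]
    have := LinearMap.congr_fun hg ⟨q η, η, rfl⟩
    change g (M (q η) u₀) = ⟨q η, η, rfl⟩ at this
    simp [this]
  obtain ⟨s, hs⟩ := LinearMap.exists_rightInverse_of_surjective _ hp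
  have hs' : ∀ v, p u₀ (s v) = v := LinearMap.congr_fun hs
  -- By `hA`, A u is X₀⁻¹ composed with v ↦ M v u; apolarity ensures that this composition stays in
  -- the range of q.
  let A : U → Module.End ℂ (LinearMap.range q) := fun u => p u ∘ₗ s
  have hA : ∀ u v, M (A u v : V) u₀ = M (v : V) u := fun u v => by
    conv_rhs => rw [← hs' v]
    exact h.apply_comm (s v) u u₀
  have hcomm : ∀ u w, Commute (A u) (A w) := by
    intro u w
    refine LinearMap.ext fun v => LinearMap.ker_eq_bot.1 hX₀ ?_
    change M (A u (A w v) : V) u₀ = M (A w (A u v) : V) u₀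
    rw [hA, hA]
    exact h.apply_comm (s v) w u
  have : Nontrivial (LinearMap.range q) := by
    rw [Submodule.nontrivial_iff_ne_bot]
    exact fun hb => hq (LinearMap.range_eq_bot.1 hb)
  let b : Basis (Fin 3) ℂ U := finBasisOfFinrankEq ℂ U hU
  obtain ⟨v, hv, c, hc⟩ := exists_common_eigenvector 3 (fun i => A (b i)) fun i j => hcomm _ _
  refine ⟨v, by simpa using hv, fun u => ?_⟩
  rw [← b.sum_repr u, map_sum]
  refine Submodule.sum_mem _ fun i _ => ?_
  rw [map_smul]
  refine Submodule.smul_mem _ _ (Submodule.mem_span_singleton.2 ⟨c i, ?_⟩)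
  rw [← hA (b i) v, hc]
  simp

end IsApolar

/-- If `I` has dimension one or two, then some vector is killed by no nonzero `M v`, `v ∈ I`. -/
theorem IsNondegenerate.exists_apply_ne_zero_of_finrank_le_two [FiniteDimensional ℂ U]
    [FiniteDimensional ℂ V] {M : V →ₗ[ℂ] U →ₗ[ℂ] W} (hM : IsNondegenerate M)
    (hU : finrank ℂ U = 3) (I : Submodule ℂ V) (hI0 : I ≠ ⊥) (hI : finrank ℂ I ≤ 2) :
    ∃ u, ∀ v ∈ I, M v u = 0 → v = 0 := by
  by_contra! hs
  obtain ⟨v₁, hv₁, hv₁0⟩ := (Submodule.ne_bot_iff _).1 hI0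
  have h1 : 2 ≤ finrank ℂ (LinearMap.range (M v₁)) := by
    by_contra hlt
    have h3 := (M v₁).finrank_range_add_finrank_ker
    obtain ⟨x, hx, y, hy, hxy⟩ := exists_pair_of_two_le_finrank (LinearMap.ker (M v₁)) (by omega)
    exact hM.ker_le v₁ hv₁0 x y hx hy hxy
  obtain ⟨_, ⟨x, rfl⟩, _, ⟨y, rfl⟩, hxy⟩ := exists_pair_of_two_le_finrank _ h1
  have hxy' := LinearIndependent.pair_iff.1 hxy
  obtain ⟨a, haI, hax, ha0⟩ := hs x
  have hind : LinearIndependent ℂ ![v₁, a] := by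
    rw [LinearIndependent.pair_iff' hv₁0]
    rintro c rfl
    have hc : c ≠ 0 := by rintro rfl; simp at ha0
    rw [map_smul, LinearMap.smul_apply, smul_eq_zero_iff_right hc] at hax
    exact one_ne_zero (hxy' 1 0 (by simp [hax])).1
  have hspan : ∀ w ∈ I, ∃ s t : ℂ, s • v₁ + t • a = w := by
    have hle : Submodule.span ℂ {v₁, a} ≤ I := by
      rw [Submodule.span_le]
      rintro _ (rfl | rfl) <;> assumption
    have h2 := two_le_finrank_of_pair (Submodule.span ℂ {v₁, a})
      (Submodule.subset_span (by simp)) (Submodule.subset_span (by simp)) hind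
    have heq := Submodule.eq_of_le_of_finrank_le hle (by omega)
    intro w hw
    rwa [← heq, Submodule.mem_span_pair] at hw
  -- A nonzero vector of I that kills z is not a multiple of v₁, so z is an eigenvector of M a
  -- relative to M v₁.
  have key : ∀ z, M v₁ z ≠ 0 → ∃ c : ℂ, M a z = c • M v₁ z := by
    intro z hz
    obtain ⟨w, hw, hwz, hw0⟩ := hs z
    obtain ⟨s, t, rfl⟩ := hspan w hw
    have ht : t ≠ 0 := by
      rintro rfl
      have hs0 : s ≠ 0 := by rintro rfl; simp at hw0
      simp [hs0, hz] at hwz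
    refine ⟨-s / t, ?_⟩
    simp only [map_add, map_smul, LinearMap.add_apply, LinearMap.smul_apply] at hwz
    rw [div_eq_inv_mul, mul_smul, eq_inv_smul_iff₀ ht, neg_smul]
    exact eq_neg_of_add_eq_zero_right hwz
  -- The relative eigenvalue at x is 0. As y and x + y are eigenvectors too, it is also 0 at y, so a
  -- kills both x and y.
  obtain ⟨c, hc⟩ := key y fun h0 => one_ne_zero (hxy' 0 1 (by simp [h0])).2
  obtain ⟨d, hd⟩ := key (x + y) fun h0 =>
    one_ne_zero (hxy' 1 1 (by rw [map_add] at h0; simpa using h0)).1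
  rw [map_add, map_add, hax, hc, zero_add, smul_add] at hd
  have h2 := hxy' d (d - c) (by rw [sub_smul, hd]; abel)
  have hay : M a y = 0 := by
    have : c = 0 := by linear_combination h2.1 - h2.2
    rw [hc, this, zero_smul]
  refine hM.ker_le a ha0 x y hax hay ?_
  rw [LinearIndependent.pair_iff]
  intro s t hst
  exact hxy' s t (by rw [← map_smul, ← map_smul, ← map_add, hst, map_zero])

theorem exists_mem_inf_of_finrank_eq_three {X : Type*} [AddCommGroup X] [Module ℂ X]
    [FiniteDimensional ℂ X] (hX : finrank ℂ X = 3) (P P' : Submodule ℂ X)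
    (hP : 2 ≤ finrank ℂ P) (hP' : 2 ≤ finrank ℂ P') : ∃ x ≠ 0, x ∈ P ∧ x ∈ P' := by
  have h1 := Submodule.finrank_sup_add_finrank_inf_eq P P'
  have h2 := Submodule.finrank_le (P ⊔ P')
  have h3 : P ⊓ P' ≠ ⊥ := by
    intro h0
    rw [h0, finrank_bot] at h1
    omega
  obtain ⟨x, hx, hx0⟩ := (Submodule.ne_bot_iff _).1 h3
  exact ⟨x, hx0, hx⟩

namespace IsApolar

variable {M : V →ₗ[ℂ] U →ₗ[ℂ] W} {q : Dual ℂ V →ₗ[ℂ] V} [FiniteDimensional ℂ U]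
  [FiniteDimensional ℂ W] [FiniteDimensional ℂ V]

/-- If `X_u : v ↦ M v u` is singular on the three-dimensional range `I` of `q` with a kernel of
dimension one, then a covector `α` that kills its image also satisfies `α ∘ M v = 0` for `v` in a
plane in `I`. -/
theorem exists_dual_of_singular (h : IsApolar M q) (hW : finrank ℂ W = 3)
    (hI : finrank ℂ (LinearMap.range q) = 3) (u : U)
    (hs : ∃ v ∈ LinearMap.range q, M v u = 0 ∧ v ≠ 0)
    (hu : finrank ℂ (LinearMap.ker ((M.flip u).domRestrict (LinearMap.range q))) < 2) :
    ∃ α : Dual ℂ W, α ≠ 0 ∧ (∀ v ∈ LinearMap.range q, α (M v u) = 0) ∧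
      2 ≤ finrank ℂ (LinearMap.ker
        ((LinearMap.llcomp ℂ U W ℂ α ∘ₗ M).domRestrict (LinearMap.range q))) := by
  set X := (M.flip u).domRestrict (LinearMap.range q) with hX
  have hns : ¬ Function.Surjective X := by
    rw [← LinearMap.injective_iff_surjective_of_finrank_eq_finrank (by rw [hI, hW])]
    intro hinj
    obtain ⟨v, hv, hvu, hv0⟩ := hs
    have := @hinj ⟨v, hv⟩ 0 (by rw [map_zero]; exact hvu)
    exact hv0 (congrArg Subtype.val this)
  obtain ⟨α, hα, hαX⟩ := Submodule.exists_le_ker_of_lt_top (LinearMap.range X)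
    (lt_top_iff_ne_top.2 fun h0 => hns (LinearMap.range_eq_top.1 h0))
  have hαu : ∀ v ∈ LinearMap.range q, α (M v u) = 0 := fun v hv => hαX ⟨⟨v, hv⟩, rfl⟩
  refine ⟨α, hα, hαu, ?_⟩
  let T : U →ₗ[ℂ] V := q ∘ₗ LinearMap.llcomp ℂ V W ℂ α ∘ₗ M.flip
  set A := (LinearMap.llcomp ℂ U W ℂ α ∘ₗ M).domRestrict (LinearMap.range q) with hA
  -- This form vanishes on the range of q, hence is killed by the symmetric map q.
  have hqu : q (α ∘ₗ M.flip u) = 0 := by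
    refine (forall_dual_apply_eq_zero_iff ℂ _).1 fun η => ?_
    rw [h.symm]
    exact hαu _ ⟨η, rfl⟩
  have hT : ∀ w, M (T w) u = 0 := fun w => by
    have := h.apply_comm α w u
    rwa [hqu, map_zero, LinearMap.zero_apply] at this
  have hT1 : finrank ℂ (LinearMap.range T) < 2 := by
    refine lt_of_le_of_lt ?_ hu
    let T' : U →ₗ[ℂ] LinearMap.range q := q.rangeRestrict ∘ₗ LinearMap.llcomp ℂ V W ℂ α ∘ₗ M.flip
    have hTT : T = (LinearMap.range q).subtype ∘ₗ T' := rfl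
    rw [hTT, LinearMap.range_comp]
    refine (Submodule.finrank_map_le _ _).trans (Submodule.finrank_mono ?_)
    rintro _ ⟨w, rfl⟩
    exact hT w
  -- Thus A has the rank of T, at most one, and its kernel in the three-dimensional range is at
  -- least a plane.
  have hAT : A ∘ₗ q.rangeRestrict = T.dualMap := by
    refine LinearMap.ext fun ξ => LinearMap.ext fun w => ?_
    exact h.symm (α ∘ₗ M.flip w) ξ |>.symm
  have hAr : LinearMap.range A = LinearMap.range T.dualMap := by
    rw [← hAT, LinearMap.range_comp_of_range_eq_top _ q.range_rangeRestrict]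
  have h1 := A.finrank_range_add_finrank_ker
  rw [hAr, LinearMap.finrank_range_dualMap_eq_finrank_range] at h1
  omega

/-- If the range of `q` has dimension three, then some vector is killed by no nonzero `M v` with `v`
in this range. -/
theorem exists_apply_ne_zero_of_finrank_eq_three (h : IsApolar M q) (hM : IsNondegenerate M)
    (hU : finrank ℂ U = 3) (hW : finrank ℂ W = 3) (hV : finrank ℂ V = 4)
    (hI : finrank ℂ (LinearMap.range q) = 3) :
    ∃ u, ∀ v ∈ LinearMap.range q, M v u = 0 → v = 0 := by
  by_contra! hs
  -- Two planes in the three-dimensional range meet, and a common v would have rank at most one. So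
  -- the exceptional u lie on one line; `hG` is the same for covectors.
  have hE : ∀ u w, LinearIndependent ℂ ![u, w] →
      2 ≤ finrank ℂ (LinearMap.ker ((M.flip u).domRestrict (LinearMap.range q))) →
      finrank ℂ (LinearMap.ker ((M.flip w).domRestrict (LinearMap.range q))) < 2 := by
    intro u w huw hu
    by_contra! hw
    obtain ⟨v, hv0, hvu, hvw⟩ := exists_mem_inf_of_finrank_eq_three hI _ _ hu hw
    exact hM.ker_le v (by simpa using hv0) u w hvu hvw huw
  have hG : ∀ α β : Dual ℂ W, LinearIndependent ℂ ![α, β] →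
      2 ≤ finrank ℂ (LinearMap.ker
        ((LinearMap.llcomp ℂ U W ℂ α ∘ₗ M).domRestrict (LinearMap.range q))) →
      ¬ 2 ≤ finrank ℂ (LinearMap.ker
        ((LinearMap.llcomp ℂ U W ℂ β ∘ₗ M).domRestrict (LinearMap.range q))) := by
    intro α β hαβ hα hβ
    obtain ⟨v, hv0, hvα, hvβ⟩ := exists_mem_inf_of_finrank_eq_three hI _ _ hα hβ
    exact (hM.transpose hU hW).ker_le v (by simpa using hv0) α β hvα hvβ hαβ
  obtain ⟨u₀, hu₀⟩ : ∃ u,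
      finrank ℂ (LinearMap.ker ((M.flip u).domRestrict (LinearMap.range q))) < 2 := by
    have : Nontrivial U := nontrivial_of_finrank_pos (R := ℂ) (by omega)
    obtain ⟨x, hx⟩ := exists_ne (0 : U)
    obtain ⟨y, hxy⟩ :=
      exists_linearIndependent_pair_of_one_lt_finrank (by omega : 1 < finrank ℂ U) hx
    by_cases hx2 : 2 ≤ finrank ℂ (LinearMap.ker ((M.flip x).domRestrict (LinearMap.range q)))
    · exact ⟨y, hE x y hxy hx2⟩
    · exact ⟨x, by omega⟩
  obtain ⟨α, hα, -, hα2⟩ := h.exists_dual_of_singular hW hI u₀ (hs u₀) hu₀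
  -- By `hG` all unexceptional u have the same covector, up to a scalar.
  have hZ : ∀ u, finrank ℂ (LinearMap.ker ((M.flip u).domRestrict (LinearMap.range q))) < 2 →
      ∀ v ∈ LinearMap.range q, α (M v u) = 0 := by
    intro u hu v hv
    obtain ⟨β, hβ, hβu, hβ2⟩ := h.exists_dual_of_singular hW hI u (hs u) hu
    have hd : ¬ LinearIndependent ℂ ![β, α] := fun hd => hG _ _ hd hβ2 hα2
    rw [LinearIndependent.pair_iff' hβ] at hd
    push Not at hd
    obtain ⟨c, rfl⟩ := hd
    simp [hβu v hv]
  have hZ' : ∀ u, ∀ v ∈ LinearMap.range q, α (M v u) = 0 := by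
    intro x v hv
    by_cases hx : 2 ≤ finrank ℂ (LinearMap.ker ((M.flip x).domRestrict (LinearMap.range q)))
    · by_cases hx0 : x = 0
      · simp [hx0]
      obtain ⟨y, hxy⟩ :=
        exists_linearIndependent_pair_of_one_lt_finrank (by omega : 1 < finrank ℂ U) hx0
      have h1 := hZ y (hE x y hxy hx) v hv
      -- An exceptional x is the difference of the unexceptional x + y and y.
      have hxy' : LinearIndependent ℂ ![x, x + y] := by
        rw [LinearIndependent.pair_iff] at hxy ⊢
        intro s t hst
        have := hxy (s + t) t (by rw [← hst]; module)
        exact ⟨by linear_combination this.1 - this.2, this.2⟩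
      have h2 := hZ (x + y) (hE x _ hxy' hx) v hv
      rw [map_add, map_add, h1, add_zero] at h2
      exact h2
    · exact hZ x (by omega) v hv
  let A : V →ₗ[ℂ] Dual ℂ U := LinearMap.llcomp ℂ U W ℂ α ∘ₗ M
  have hA : LinearMap.range q ≤ LinearMap.ker A := fun v hv =>
    LinearMap.ext fun u => hZ' u v hv
  -- A kills the three-dimensional range of q, so it has rank at most one and α vanishes on a block
  -- of dimension at least two.
  have h1 := Submodule.finrank_mono hA
  have h2 := A.finrank_range_add_finrank_ker
  have h3 := Subspace.finrank_add_finrank_dualCoannihilator_eq (LinearMap.range A)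
  obtain ⟨u, hu, v, huv⟩ := hM.row_block hU hW hV hα (LinearMap.range A).dualCoannihilator
    (by omega)
  exact huv ((Submodule.mem_dualCoannihilator _).1 hu _ ⟨v, rfl⟩)

/-- A nonzero quadric that is apolar to the minors of a nondegenerate family is nondegenerate. -/
theorem injective (h : IsApolar M q) (hM : IsNondegenerate M)
    (hU : finrank ℂ U = 3) (hW : finrank ℂ W = 3) (hV : finrank ℂ V = 4) (hq : q ≠ 0) :
    Function.Injective q := by
  by_contra hi
  have hle : finrank ℂ (LinearMap.range q) ≤ 3 := by
    have h1 := q.finrank_range_add_finrank_ker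
    have h2 : finrank ℂ (LinearMap.ker q) ≠ 0 := by
      rwa [Ne, Submodule.finrank_eq_zero, LinearMap.ker_eq_bot]
    rw [Subspace.dual_finrank_eq, hV] at h1
    omega
  have hb : LinearMap.range q ≠ ⊥ := fun hb => hq (LinearMap.range_eq_bot.1 hb)
  obtain ⟨u₀, hu₀⟩ : ∃ u, ∀ v ∈ LinearMap.range q, M v u = 0 → v = 0 := by
    by_cases h2 : finrank ℂ (LinearMap.range q) ≤ 2
    · exact hM.exists_apply_ne_zero_of_finrank_le_two hU _ hb h2
    · exact h.exists_apply_ne_zero_of_finrank_eq_three hM hU hW hV (by omega)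
  obtain ⟨v, hv, hvu⟩ := h.exists_rank_le_one hq hU u₀ hu₀
  obtain ⟨u, hu⟩ := hM.exists_notMem_span hU hv (M v u₀)
  exact hu (hvu u)

end IsApolar

/-! ### Volume forms on a three-dimensional space and smoothness -/

/-- The trilinear alternating form given by an orientation. -/
noncomputable def volForm (vol : ⋀[ℂ]^3 W ≃ₗ[ℂ] ℂ) : W [⋀^Fin 3]→ₗ[ℂ] ℂ :=
  (vol : ⋀[ℂ]^3 W →ₗ[ℂ] ℂ).compAlternatingMap (exteriorPower.ιMulti ℂ 3)

theorem volForm_apply (vol : ⋀[ℂ]^3 W ≃ₗ[ℂ] ℂ) (w : Fin 3 → W) :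
    volForm vol w = vol (exteriorPower.ιMulti ℂ 3 w) := rfl

/-- An alternating 3-form is a multiple of the determinant in the basis w; if it vanished on w,
`vol` would be zero. -/
theorem volForm_ne_zero [FiniteDimensional ℂ W] (hW : finrank ℂ W = 3)
    (vol : ⋀[ℂ]^3 W ≃ₗ[ℂ] ℂ) {w : Fin 3 → W} (hw : LinearIndependent ℂ w) : volForm vol w ≠ 0 := by
  intro h0
  let b := basisOfLinearIndependentOfCardEqFinrank hw (by simp [hW])
  have hb : ⇑b = w := coe_basisOfLinearIndependentOfCardEqFinrank hw (by simp [hW])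
  have h1 : volForm vol = 0 := by
    rw [(volForm vol).eq_smul_basis_det b, hb, h0, zero_smul]
  have h2 : (vol : ⋀[ℂ]^3 W →ₗ[ℂ] ℂ) = 0 := by
    apply exteriorPower.linearMap_ext
    exact h1
  have h3 := LinearMap.congr_fun h2 (vol.symm 1)
  simp at h3

theorem exists_linearIndependent_triple [FiniteDimensional ℂ W] (hW : finrank ℂ W = 3) {x y : W}
    (h : LinearIndependent ℂ ![x, y]) : ∃ z, LinearIndependent ℂ ![x, y, z] := by
  obtain ⟨z, hz⟩ := exists_linearIndependent_snoc_of_lt_finrank h (by omega)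
  refine ⟨z, ?_⟩
  have h1 : ![x, y, z] = Fin.snoc ![x, y] z := by
    ext i
    fin_cases i <;> rfl
  rwa [h1]

theorem detCubic_eq [FiniteDimensional ℂ U] (hU : finrank ℂ U = 3) (volU : ⋀[ℂ]^3 U ≃ₗ[ℂ] ℂ)
    (volW : ⋀[ℂ]^3 W ≃ₗ[ℂ] ℂ) (B : Dual ℂ U ⊗[ℂ] W ⊗[ℂ] Dual ℂ V) {x y z : U}
    (h : LinearIndependent ℂ ![x, y, z]) (v : V) :
    detCubic volU volW B v =
      (volForm volU ![x, y, z])⁻¹ * volForm volW ![gHom B v x, gHom B v y, gHom B v z] := by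
  have h0 := volForm_ne_zero hU volU h
  have h1 : volU.symm 1 =
      (volForm volU ![x, y, z])⁻¹ • exteriorPower.ιMulti ℂ 3 ![x, y, z] := by
    rw [LinearEquiv.symm_apply_eq, map_smul, ← volForm_apply, smul_eq_mul, inv_mul_cancel₀ h0]
  rw [detCubic, h1, map_smul, map_smul, exteriorPower.map_apply_ιMulti, smul_eq_mul, volForm_apply]
  congr 4

/-- The first column is divisible by t, so the variation of the other two enters only at order t².
-/
theorem hasDerivAt_alternating (D : W [⋀^Fin 3]→ₗ[ℂ] ℂ) (b₁ a₂ b₂ a₃ b₃ : W) :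
    HasDerivAt (fun t : ℂ => D ![t • b₁, a₂ + t • b₂, a₃ + t • b₃]) (D ![b₁, a₂, a₃]) 0 := by
  have h : ∀ t : ℂ, D ![t • b₁, a₂ + t • b₂, a₃ + t • b₃] =
      t * D ![b₁, a₂, a₃] + t ^ 2 * (D ![b₁, b₂, a₃] + D ![b₁, a₂, b₃] + t * D ![b₁, b₂, b₃]) := by
    intro t
    have e1 : ∀ (c : ℂ) (x y z : W), D ![c • x, y, z] = c * D ![x, y, z] := fun c x y z =>
      D.map_vecCons_smul ![y, z] c x
    have e2 : ∀ x y y' z : W, D ![x, y + y', z] = D ![x, y, z] + D ![x, y', z] :=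
      fun x y y' z => (D.curryLeft x).map_vecCons_add ![z] y y'
    have e3 : ∀ (c : ℂ) (x y z : W), D ![x, c • y, z] = c * D ![x, y, z] :=
      fun c x y z => (D.curryLeft x).map_vecCons_smul ![z] c y
    have e4 : ∀ x y z z' : W, D ![x, y, z + z'] = D ![x, y, z] + D ![x, y, z'] :=
      fun x y z z' => ((D.curryLeft x).curryLeft y).map_vecCons_add ![] z z'
    have e5 : ∀ (c : ℂ) (x y z : W), D ![x, y, c • z] = c * D ![x, y, z] :=
      fun c x y z => ((D.curryLeft x).curryLeft y).map_vecCons_smul ![] c z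
    simp only [e1, e2, e3, e4, e5]
    ring
  simp only [h]
  have := ((hasDerivAt_id (0 : ℂ)).mul_const (D ![b₁, a₂, a₃])).add
    (((hasDerivAt_id (0 : ℂ)).pow 2).mul (((hasDerivAt_id (0 : ℂ)).mul_const
      (D ![b₁, b₂, b₃])).const_add (D ![b₁, b₂, a₃] + D ![b₁, a₂, b₃])))
  exact this.congr_deriv (by simp)

/-- Complete a kernel vector x of M v to a basis x, y, z. The derivative of the determinant at v
along v' is a nonzero multiple of vol(M v' x, M v y, M v z). It vanishes for all v' if y is also in
the kernel, and it vanishes for any v' that puts all three vectors in ker α. -/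
theorem isNondegenerate_of_isSmooth [FiniteDimensional ℂ U] [FiniteDimensional ℂ W]
    (hU : finrank ℂ U = 3) (hW : finrank ℂ W = 3) (volU : ⋀[ℂ]^3 U ≃ₗ[ℂ] ℂ)
    (volW : ⋀[ℂ]^3 W ≃ₗ[ℂ] ℂ) (B : Dual ℂ U ⊗[ℂ] W ⊗[ℂ] Dual ℂ V)
    (hB : IsSmoothHypersurface (detCubic volU volW B)) : IsNondegenerate (gHom B) := by
  have key : ∀ v, v ≠ 0 → ∀ x y z : U, LinearIndependent ℂ ![x, y, z] → gHom B v x = 0 →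
      ∃ v', volForm volW ![gHom B v' x, gHom B v y, gHom B v z] ≠ 0 := by
    intro v hv x y z hxyz hx
    obtain ⟨v', hv'⟩ := hB v hv (by
      rw [detCubic_eq hU volU volW B hxyz, hx]
      rw [(volForm volW).map_coord_zero 0 rfl, mul_zero])
    refine ⟨v', fun h0 => hv' ?_⟩
    have h1 := (hasDerivAt_alternating (volForm volW) (gHom B v' x) (gHom B v y) (gHom B v' y)
      (gHom B v z) (gHom B v' z)).const_mul (volForm volU ![x, y, z])⁻¹
    rw [h0, mul_zero] at h1
    simp only [detCubic_eq hU volU volW B hxyz, map_add, map_smul, LinearMap.add_apply,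
      LinearMap.smul_apply, hx, zero_add]
    exact h1.deriv
  refine ⟨fun v hv x y hx hy hxy => ?_, fun v hv x hx α hα hvx hαv => ?_⟩
  · obtain ⟨z, hz⟩ := exists_linearIndependent_triple hU hxy
    obtain ⟨v', hv'⟩ := key v hv x y z hz hx
    exact hv' ((volForm volW).map_coord_zero 1 hy)
  · obtain ⟨y, hxy⟩ :=
      exists_linearIndependent_pair_of_one_lt_finrank (by omega : 1 < finrank ℂ U) hx
    obtain ⟨z, hz⟩ := exists_linearIndependent_triple hU hxy
    obtain ⟨v', hv'⟩ := key v hv x y z hz hvx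
    refine ⟨v', fun h0 => hv' ((volForm volW).map_linearDependent _ fun hli => hα ?_)⟩
    let b := basisOfLinearIndependentOfCardEqFinrank hli (by simp [hW])
    refine b.ext fun i => ?_
    rw [coe_basisOfLinearIndependentOfCardEqFinrank]
    fin_cases i
    · exact h0
    · exact hαv y
    · exact hαv z

/-! ### The Schur quadric -/

theorem apply_quadricMap (Q : V ⊗[ℂ] V) (ξ η : Dual ℂ V) :
    η (quadricMap Q ξ) = TensorProduct.dualDistrib ℂ V V (ξ ⊗ₜ η) Q := by
  induction Q with
  | zero => simp [quadricMap]
  | tmul x y => simp [quadricMap]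
  | add x y hx hy =>
    rw [map_add, ← hx, ← hy]
    simp [quadricMap]

theorem tensor_eq_zero_of_dual {X Y : Type*} [AddCommGroup X] [Module ℂ X] [AddCommGroup Y]
    [Module ℂ Y] [FiniteDimensional ℂ X] [FiniteDimensional ℂ Y] (t : X ⊗[ℂ] Y)
    (h : ∀ (f : Dual ℂ X) (g : Dual ℂ Y), TensorProduct.dualDistrib ℂ X Y (f ⊗ₜ g) t = 0) :
    t = 0 := by
  refine (forall_dual_apply_eq_zero_iff ℂ t).1 fun φ => ?_
  obtain ⟨s, rfl⟩ := (TensorProduct.dualDistribEquiv ℂ X Y).surjective φ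
  change TensorProduct.dualDistrib ℂ X Y s t = 0
  induction s with
  | zero => simp
  | tmul f g => exact h f g
  | add x y hx hy => rw [map_add, LinearMap.add_apply, hx, hy, add_zero]

theorem quadricMap_injective [FiniteDimensional ℂ V] {Q : V ⊗[ℂ] V} (h : quadricMap Q = 0) :
    Q = 0 :=
  tensor_eq_zero_of_dual Q fun f g => by rw [← apply_quadricMap, h]; simp

theorem wedgeIncl_wedge (M : Type*) [AddCommGroup M] [Module ℂ M] (a b : M) :
    wedgeIncl M (wedge M (a ⊗ₜ b)) = a ⊗ₜ b - b ⊗ₜ a :=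
  exteriorPower.alternatingMapLinearEquiv_apply_ιMulti _ ![a, b]

/-- The functional on `Λ² U^∨ ⊗ Λ² W` which is evaluation at `(u ∧ u') ⊗ (α ∧ β)`. -/
noncomputable def minorEval (u u' : U) (α β : Dual ℂ W) :
    ⋀[ℂ]^2 (Dual ℂ U) ⊗[ℂ] ⋀[ℂ]^2 W →ₗ[ℂ] ℂ :=
  TensorProduct.dualDistrib ℂ _ _
    ((TensorProduct.dualDistrib ℂ (Dual ℂ U) (Dual ℂ U) (Dual.eval ℂ U u ⊗ₜ Dual.eval ℂ U u') ∘ₗ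
        wedgeIncl (Dual ℂ U)) ⊗ₜ
      (TensorProduct.dualDistrib ℂ W W (α ⊗ₜ β) ∘ₗ wedgeIncl W))

theorem minorEval_map_wedge (u u' : U) (α β : Dual ℂ W) (s t : Dual ℂ U ⊗[ℂ] W) :
    minorEval u u' α β (TensorProduct.map (wedge (Dual ℂ U)) (wedge W)
      (TensorProduct.tensorTensorTensorComm ℂ (Dual ℂ U) W (Dual ℂ U) W (s ⊗ₜ t))) =
    α (dualTensorHom ℂ U W s u) * β (dualTensorHom ℂ U W t u')
      - α (dualTensorHom ℂ U W s u') * β (dualTensorHom ℂ U W t u)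
      - β (dualTensorHom ℂ U W s u) * α (dualTensorHom ℂ U W t u')
      + β (dualTensorHom ℂ U W s u') * α (dualTensorHom ℂ U W t u) := by
  induction s with
  | zero => simp
  | add x y hx hy =>
    rw [TensorProduct.add_tmul, map_add, map_add, map_add, hx, hy]
    simp only [map_add, LinearMap.add_apply]
    ring
  | tmul φ w =>
    induction t with
    | zero => simp
    | add x y hx hy =>
      rw [TensorProduct.tmul_add, map_add, map_add, map_add, hx, hy]
      simp only [map_add, LinearMap.add_apply]
      ring
    | tmul ψ w' =>
      rw [TensorProduct.tensorTensorTensorComm_tmul, TensorProduct.map_tmul, minorEval,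
        TensorProduct.dualDistrib_apply, LinearMap.comp_apply, LinearMap.comp_apply,
        wedgeIncl_wedge, wedgeIncl_wedge]
      simp
      ring

theorem minorEval_schurMap (B : Dual ℂ U ⊗[ℂ] W ⊗[ℂ] Dual ℂ V) (u u' : U) (α β : Dual ℂ W)
    (Q : V ⊗[ℂ] V) :
    minorEval u u' α β (schurMap B Q) =
      TensorProduct.dualDistrib ℂ V V ((α ∘ₗ (gHom B).flip u) ⊗ₜ (β ∘ₗ (gHom B).flip u')) Q
      - TensorProduct.dualDistrib ℂ V V ((α ∘ₗ (gHom B).flip u') ⊗ₜ (β ∘ₗ (gHom B).flip u)) Q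
      - TensorProduct.dualDistrib ℂ V V ((β ∘ₗ (gHom B).flip u) ⊗ₜ (α ∘ₗ (gHom B).flip u')) Q
      + TensorProduct.dualDistrib ℂ V V ((β ∘ₗ (gHom B).flip u') ⊗ₜ (α ∘ₗ (gHom B).flip u)) Q := by
  induction Q with
  | zero => simp
  | add x y hx hy =>
    simp only [map_add, hx, hy]
    ring
  | tmul v v' => exact minorEval_map_wedge u u' α β (gV B v) (gV B v')

theorem isApolar_quadricMap (B : Dual ℂ U ⊗[ℂ] W ⊗[ℂ] Dual ℂ V) [FiniteDimensional ℂ V]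
    {Q : V ⊗[ℂ] V} (hQ : Q ∈ schurKernel B) : IsApolar (gHom B) (quadricMap Q) := by
  have hsymm : ∀ ξ η : Dual ℂ V, η (quadricMap Q ξ) = ξ (quadricMap Q η) := by
    intro ξ η
    have h1 : TensorProduct.comm ℂ V V Q = Q := hQ.1
    rw [apply_quadricMap, apply_quadricMap]
    conv_rhs => rw [← h1]
    clear h1 hQ
    induction Q with
    | zero => simp
    | tmul x y => simp [mul_comm]
    | add x y hx hy => simp only [map_add, hx, hy]
  refine ⟨hsymm, fun α β u u' => ?_⟩
  have h0 := minorEval_schurMap B u u' α β Q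
  rw [LinearMap.mem_ker.1 hQ.2, map_zero] at h0
  simp only [← apply_quadricMap] at h0
  -- Symmetry of Q makes the four terms agree in pairs, whence the division by 2.
  rw [hsymm (β ∘ₗ (gHom B).flip u'), hsymm (α ∘ₗ (gHom B).flip u')] at h0
  simp only [LinearMap.comp_apply, LinearMap.flip_apply] at h0
  linear_combination -h0 / 2

/-- S² V has dimension at least 16 − 6 = 10, as the range of swap − id lies in the image of Λ² V,
and the target has dimension 3 · 3 = 9. -/
theorem one_le_finrank_schurKernel [FiniteDimensional ℂ U] [FiniteDimensional ℂ W]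
    [FiniteDimensional ℂ V] (hU : finrank ℂ U = 3) (hW : finrank ℂ W = 3) (hV : finrank ℂ V = 4)
    (B : Dual ℂ U ⊗[ℂ] W ⊗[ℂ] Dual ℂ V) : 1 ≤ finrank ℂ (schurKernel B) := by
  let S : V ⊗[ℂ] V →ₗ[ℂ] V ⊗[ℂ] V := (TensorProduct.comm ℂ V V).toLinearMap - LinearMap.id
  have hS : symTensors V = LinearMap.ker S := LinearMap.eqLocus_eq_ker_sub _ _
  have hSr : LinearMap.range S ≤ LinearMap.range (wedgeIncl V) := by
    rintro _ ⟨t, rfl⟩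
    induction t with
    | zero => simp
    | tmul a b => exact ⟨wedge V (b ⊗ₜ a), wedgeIncl_wedge V b a⟩
    | add x y hx hy => rw [map_add]; exact Submodule.add_mem _ hx hy
  have h1 := (Submodule.finrank_mono hSr).trans (LinearMap.finrank_range_le _)
  rw [exteriorPower.finrank_eq, hV] at h1
  have h2 := S.finrank_range_add_finrank_ker
  have h3 := LinearMap.finrank_range_add_finrank_ker (K := ℂ) (V := V ⊗[ℂ] V)
    (V₂ := ⋀[ℂ]^2 (Dual ℂ U) ⊗[ℂ] ⋀[ℂ]^2 W) (schurMap B)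
  have h4 := Submodule.finrank_le (LinearMap.range (schurMap B))
  have h5 := Submodule.finrank_sup_add_finrank_inf_eq (symTensors V) (LinearMap.ker (schurMap B))
  have h6 := Submodule.finrank_le (symTensors V ⊔ LinearMap.ker (schurMap B))
  rw [finrank_tensorProduct, exteriorPower.finrank_eq, exteriorPower.finrank_eq,
    Subspace.dual_finrank_eq, hU, hW] at h4
  rw [finrank_tensorProduct, hV] at h2 h3 h6
  rw [hS] at h5 h6
  rw [schurKernel, hS]
  have e1 : Nat.choose 4 2 = 6 := rfl
  have e2 : Nat.choose 3 2 = 3 := rfl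
  rw [e1] at h1
  rw [e2] at h4
  omega

/-- The Schur quadric of a nondegenerate tensor is unique up to a scalar factor. -/
theorem finrank_schurKernel [FiniteDimensional ℂ U] [FiniteDimensional ℂ W]
    [FiniteDimensional ℂ V] (hU : finrank ℂ U = 3) (hW : finrank ℂ W = 3) (hV : finrank ℂ V = 4)
    (B : Dual ℂ U ⊗[ℂ] W ⊗[ℂ] Dual ℂ V) (hB : IsNondegenerate (gHom B)) :
    finrank ℂ (schurKernel B) = 1 := by
  have : Nontrivial (schurKernel B) :=
    nontrivial_of_finrank_pos (R := ℂ) (one_le_finrank_schurKernel hU hW hV B)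
  obtain ⟨Q, hQ⟩ := exists_ne (0 : schurKernel B)
  rw [finrank_eq_one_iff_of_nonzero' Q hQ]
  intro Q'
  have hlin : ∀ (s t : ℂ) (ξ : Dual ℂ V), quadricMap (s • (Q : V ⊗[ℂ] V) + t • (Q' : V ⊗[ℂ] V)) ξ =
      s • quadricMap (Q : V ⊗[ℂ] V) ξ + t • quadricMap (Q' : V ⊗[ℂ] V) ξ := by
    intro s t ξ
    simp [quadricMap]
  obtain ⟨s, t, hst, ξ, hξ, h0⟩ := exists_singular_in_pencil
    (by rw [Subspace.dual_finrank_eq, hV]; norm_num) (by rw [Subspace.dual_finrank_eq])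
    (quadricMap (Q : V ⊗[ℂ] V)) (quadricMap (Q' : V ⊗[ℂ] V))
  rw [← hlin] at h0
  -- A nonzero member of the pencil would be nondegenerate, but this one kills ξ.
  have hz : s • Q + t • Q' = 0 := by
    by_contra hne
    have hmem := (s • Q + t • Q').2
    have hq := (isApolar_quadricMap B hmem).injective hB hU hW hV fun hq =>
      hne (Subtype.ext (quadricMap_injective hq))
    exact hξ (hq (h0.trans (map_zero _).symm))
  have ht : t ≠ 0 := by
    rintro rfl
    have hs : s ≠ 0 := by tauto
    simp [hs, hQ] at hz
  refine ⟨-s / t, ?_⟩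
  rw [div_eq_inv_mul, mul_smul, inv_smul_eq_iff₀ ht, neg_smul]
  exact (eq_neg_of_add_eq_zero_right hz).symm

/-! ### The space `U'` -/

theorem dualDistrib_lTensor_gU {Y : Type*} [AddCommGroup Y] [Module ℂ Y]
    (B : Dual ℂ U ⊗[ℂ] W ⊗[ℂ] Dual ℂ V) (L : Dual ℂ V →ₗ[ℂ] Y) (u : U) (α : Dual ℂ W)
    (β : Dual ℂ Y) :
    TensorProduct.dualDistrib ℂ W Y (α ⊗ₜ β) (LinearMap.lTensor W L (gU B u)) =
      β (L (α ∘ₗ (gHom B).flip u)) := by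
  induction B with
  | zero =>
    have h1 : α ∘ₗ (gHom (0 : Dual ℂ U ⊗[ℂ] W ⊗[ℂ] Dual ℂ V)).flip u = 0 := by
      ext; simp [gHom, gV]
    rw [h1]
    simp [gU]
  | add x y hx hy =>
    have h1 : α ∘ₗ (gHom (x + y)).flip u =
        α ∘ₗ (gHom x).flip u + α ∘ₗ (gHom y).flip u := by
      ext; simp [gHom, gV]
    rw [h1, map_add, map_add, ← hx, ← hy]
    simp [gU]
  | tmul s ξ =>
    induction s with
    | zero =>
      have h1 : α ∘ₗ (gHom ((0 : Dual ℂ U ⊗[ℂ] W) ⊗ₜ[ℂ] ξ)).flip u = 0 := by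
        ext; simp [gHom, gV]
      rw [h1]
      simp [gU]
    | add x y hx hy =>
      have h1 : α ∘ₗ (gHom ((x + y) ⊗ₜ[ℂ] ξ)).flip u =
          α ∘ₗ (gHom (x ⊗ₜ[ℂ] ξ)).flip u + α ∘ₗ (gHom (y ⊗ₜ[ℂ] ξ)).flip u := by
        ext; simp [gHom, gV]
      rw [h1, map_add, map_add, ← hx, ← hy]
      simp [gU, TensorProduct.add_tmul]
    | tmul φ w =>
      have h1 : α ∘ₗ (gHom ((φ ⊗ₜ[ℂ] w) ⊗ₜ[ℂ] ξ)).flip u = (φ u * α w) • ξ := by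
        ext v
        simp [gHom, gV]
        ring
      rw [h1]
      simp [gU]
      ring

theorem pairingDual_wedge (θ : ⋀[ℂ]^2 (Dual ℂ W)) (x y : W) :
    exteriorPower.pairingDual ℂ W 2 θ (wedge W (x ⊗ₜ y)) =
      TensorProduct.dualDistrib ℂ (Dual ℂ W) (Dual ℂ W) (Dual.eval ℂ W x ⊗ₜ Dual.eval ℂ W y)
        (wedgeIncl (Dual ℂ W) θ) := by
  suffices h : (exteriorPower.pairingDual ℂ W 2).flip (wedge W (x ⊗ₜ y)) =
      TensorProduct.dualDistrib ℂ (Dual ℂ W) (Dual ℂ W) (Dual.eval ℂ W x ⊗ₜ Dual.eval ℂ W y) ∘ₗ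
        wedgeIncl (Dual ℂ W) from LinearMap.congr_fun h θ
  refine exteriorPower.linearMap_ext (AlternatingMap.ext fun f => ?_)
  change exteriorPower.pairingDual ℂ W 2 (exteriorPower.ιMulti ℂ 2 f)
      (exteriorPower.ιMulti ℂ 2 ![x, y]) = TensorProduct.dualDistrib ℂ (Dual ℂ W) (Dual ℂ W)
        (Dual.eval ℂ W x ⊗ₜ Dual.eval ℂ W y) (wedgeIncl _ (exteriorPower.ιMulti ℂ 2 f))
  rw [exteriorPower.pairingDual_ιMulti_ιMulti, wedgeIncl,
    exteriorPower.alternatingMapLinearEquiv_apply_ιMulti, Matrix.det_fin_two]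
  simp

/-- As 2 is invertible, this makes `wedgeIncl` injective. -/
theorem wedge_wedgeIncl (M : Type*) [AddCommGroup M] [Module ℂ M] (θ : ⋀[ℂ]^2 M) :
    wedge M (wedgeIncl M θ) = (2 : ℂ) • θ := by
  suffices h : wedge M ∘ₗ wedgeIncl M = (2 : ℂ) • LinearMap.id from LinearMap.congr_fun h θ
  refine exteriorPower.linearMap_ext (AlternatingMap.ext fun f => ?_)
  change wedge M (wedgeIncl M (exteriorPower.ιMulti ℂ 2 f)) = (2 : ℂ) • exteriorPower.ιMulti ℂ 2 f
  rw [wedgeIncl, exteriorPower.alternatingMapLinearEquiv_apply_ιMulti]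
  change wedge M (f 0 ⊗ₜ f 1 - f 1 ⊗ₜ f 0) = _
  rw [map_sub]
  change exteriorPower.ιMulti ℂ 2 ![f 0, f 1] - exteriorPower.ιMulti ℂ 2 ![f 1, f 0] = _
  have h1 : ![f 0, f 1] = f := by ext i; fin_cases i <;> rfl
  have h2 : ![f 1, f 0] = f ∘ Equiv.swap 0 1 := by ext i; fin_cases i <;> simp
  rw [h1, h2, (exteriorPower.ιMulti ℂ 2).map_swap f (by simp), sub_neg_eq_add, two_smul]

theorem pairingDual_bijective [FiniteDimensional ℂ W] :
    Function.Bijective (exteriorPower.pairingDual ℂ W 2) := by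
  have hi : Function.Injective (exteriorPower.pairingDual ℂ W 2) := by
    rw [← LinearMap.ker_eq_bot, Submodule.eq_bot_iff]
    intro θ hθ
    have h1 : wedgeIncl (Dual ℂ W) θ = 0 := by
      refine tensor_eq_zero_of_dual _ fun f g => ?_
      obtain ⟨x, rfl⟩ := (evalEquiv ℂ W).surjective f
      obtain ⟨y, rfl⟩ := (evalEquiv ℂ W).surjective g
      refine (pairingDual_wedge θ x y).symm.trans ?_
      rw [LinearMap.mem_ker.1 hθ, LinearMap.zero_apply]
    have h2 := wedge_wedgeIncl (Dual ℂ W) θ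
    rw [h1, map_zero] at h2
    simpa using h2.symm
  refine ⟨hi, (LinearMap.injective_iff_surjective_of_finrank_eq_finrank ?_).1 hi⟩
  rw [Subspace.dual_finrank_eq, exteriorPower.finrank_eq, exteriorPower.finrank_eq,
    Subspace.dual_finrank_eq]

theorem orientDual_wedge (vol : ⋀[ℂ]^3 W ≃ₗ[ℂ] ℂ) (w x y : W) :
    orientDual vol w (wedge W (x ⊗ₜ y)) = volForm vol ![w, x, y] :=
  exteriorPower.alternatingMapLinearEquiv_apply_ιMulti _ ![x, y]

theorem orientDual_bijective [FiniteDimensional ℂ W] (hW : finrank ℂ W = 3)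
    (vol : ⋀[ℂ]^3 W ≃ₗ[ℂ] ℂ) : Function.Bijective (orientDual vol) := by
  have hi : Function.Injective (orientDual vol) := by
    rw [← LinearMap.ker_eq_bot, Submodule.eq_bot_iff]
    intro x hx
    by_contra hx0
    obtain ⟨y, hxy⟩ :=
      exists_linearIndependent_pair_of_one_lt_finrank (by omega : 1 < finrank ℂ W) hx0
    obtain ⟨z, hz⟩ := exists_linearIndependent_triple hW hxy
    apply volForm_ne_zero hW vol hz
    rw [← orientDual_wedge, LinearMap.mem_ker.1 hx, LinearMap.zero_apply]
  refine ⟨hi, (LinearMap.injective_iff_surjective_of_finrank_eq_finrank ?_).1 hi⟩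
  rw [Subspace.dual_finrank_eq, exteriorPower.finrank_eq, hW]
  rfl

/-- Surjectivity leaves a kernel of dimension 3 · 4 − 3 · 3. -/
theorem finrank_crossSpace [FiniteDimensional ℂ U] [FiniteDimensional ℂ W] [FiniteDimensional ℂ V]
    (hU : finrank ℂ U = 3) (hW : finrank ℂ W = 3) (hV : finrank ℂ V = 4)
    (vol : ⋀[ℂ]^3 W ≃ₗ[ℂ] ℂ) (B : Dual ℂ U ⊗[ℂ] W ⊗[ℂ] Dual ℂ V) (hB : MainAssumption B) :
    finrank ℂ (crossSpace vol B) = 3 := by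
  have h1 := LinearMap.finrank_range_add_finrank_ker (K := ℂ) (V := ⋀[ℂ]^2 (Dual ℂ W) ⊗[ℂ] V)
    (V₂ := Dual ℂ U ⊗[ℂ] Dual ℂ W) (contraction B)
  rw [LinearMap.range_eq_top.2 hB, finrank_top, finrank_tensorProduct, finrank_tensorProduct,
    exteriorPower.finrank_eq, Subspace.dual_finrank_eq, Subspace.dual_finrank_eq, hU, hW, hV] at h1
  let e₁ := (LinearEquiv.ofBijective _ (pairingDual_bijective (W := W))).rTensor V
  let e₂ := (LinearEquiv.ofBijective _ (orientDual_bijective hW vol)).rTensor V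
  have h2 : crossSpace vol B = ((LinearMap.ker (contraction B)).map e₁.toLinearMap).map
      e₂.symm.toLinearMap := by
    rw [Submodule.map_equiv_eq_comap_symm e₂.symm]
    rfl
  rw [h2, LinearEquiv.finrank_map_eq, LinearEquiv.finrank_map_eq]
  have e : Nat.choose 3 2 = 3 := rfl
  rw [e] at h1
  omega

/-- The functional `f ⊗ v ↦ f (B(v) u ∧ y)` on `(Λ² W)^∨ ⊗ V`. -/
noncomputable def wedgeEval (B : Dual ℂ U ⊗[ℂ] W ⊗[ℂ] Dual ℂ V) (u : U) (y : W) :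
    Dual ℂ (⋀[ℂ]^2 W) ⊗[ℂ] V →ₗ[ℂ] ℂ :=
  contractLeft ℂ (⋀[ℂ]^2 W) ∘ₗ LinearMap.lTensor _
    (wedge W ∘ₗ (TensorProduct.mk ℂ W W).flip y ∘ₗ (gHom B).flip u)

theorem wedgeEval_tmul (B : Dual ℂ U ⊗[ℂ] W ⊗[ℂ] Dual ℂ V) (u : U) (y : W)
    (f : Dual ℂ (⋀[ℂ]^2 W)) (v : V) :
    wedgeEval B u y (f ⊗ₜ v) = f (wedge W (gHom B v u ⊗ₜ y)) := rfl

theorem dualDistrib_contraction (B : Dual ℂ U ⊗[ℂ] W ⊗[ℂ] Dual ℂ V) (u : U) (y : W)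
    (s : ⋀[ℂ]^2 (Dual ℂ W) ⊗[ℂ] V) :
    TensorProduct.dualDistrib ℂ (Dual ℂ U) (Dual ℂ W) (Dual.eval ℂ U u ⊗ₜ Dual.eval ℂ W y)
      (contraction B s) =
    wedgeEval B u y (LinearMap.rTensor V (exteriorPower.pairingDual ℂ W 2) s) := by
  induction s with
  | zero => simp
  | add x y hx hy => simp only [map_add, hx, hy]
  | tmul θ v =>
    rw [LinearMap.rTensor_tmul, wedgeEval_tmul, pairingDual_wedge]
    change TensorProduct.dualDistrib ℂ (Dual ℂ U) (Dual ℂ W)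
      (Dual.eval ℂ U u ⊗ₜ Dual.eval ℂ W y)
      (LinearMap.rTensor (Dual ℂ W) (gHom B v).dualMap (wedgeIncl (Dual ℂ W) θ)) = _
    induction wedgeIncl (Dual ℂ W) θ with
    | zero => simp
    | add x y hx hy => simp only [map_add, hx, hy]
    | tmul α β => simp

theorem mem_crossSpace [FiniteDimensional ℂ U] [FiniteDimensional ℂ W]
    (vol : ⋀[ℂ]^3 W ≃ₗ[ℂ] ℂ) (B : Dual ℂ U ⊗[ℂ] W ⊗[ℂ] Dual ℂ V) {t : W ⊗[ℂ] V}
    (h : ∀ u y, wedgeEval B u y (LinearMap.rTensor V (orientDual vol) t) = 0) :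
    t ∈ crossSpace vol B := by
  obtain ⟨s, hs⟩ := LinearMap.rTensor_surjective V (pairingDual_bijective (W := W)).2
    (LinearMap.rTensor V (orientDual vol) t)
  refine ⟨s, ?_, hs⟩
  refine tensor_eq_zero_of_dual _ fun f g => ?_
  obtain ⟨x, rfl⟩ := (evalEquiv ℂ U).surjective f
  obtain ⟨y, rfl⟩ := (evalEquiv ℂ W).surjective g
  exact (dualDistrib_contraction B x y s).trans (by rw [hs, h])

/-- Contraction with u' gives a tensor τ in W ⊗ W, symmetric by apolarity. The functional left to
evaluate on it, a ⊗ b ↦ vol(a, b, y), is alternating, so the value is 0. -/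
theorem lTensor_quadricMap_mem [FiniteDimensional ℂ U] [FiniteDimensional ℂ W]
    (vol : ⋀[ℂ]^3 W ≃ₗ[ℂ] ℂ) (B : Dual ℂ U ⊗[ℂ] W ⊗[ℂ] Dual ℂ V) {q : Dual ℂ V →ₗ[ℂ] V}
    (hq : IsApolar (gHom B) q) (u : U) : LinearMap.lTensor W q (gU B u) ∈ crossSpace vol B := by
  refine mem_crossSpace vol B fun u' y => ?_
  let Ψ : W ⊗[ℂ] W →ₗ[ℂ] ℂ := contractLeft ℂ (⋀[ℂ]^2 W) ∘ₗ
    TensorProduct.map (orientDual vol) (wedge W ∘ₗ (TensorProduct.mk ℂ W W).flip y)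
  have h1 : wedgeEval B u' y ∘ₗ LinearMap.rTensor V (orientDual vol) ∘ₗ LinearMap.lTensor W q =
      Ψ ∘ₗ LinearMap.lTensor W ((gHom B).flip u' ∘ₗ q) := by
    ext; rfl
  have h2 := LinearMap.congr_fun h1 (gU B u)
  simp only [LinearMap.comp_apply] at h2
  rw [h2]
  set τ := LinearMap.lTensor W ((gHom B).flip u' ∘ₗ q) (gU B u)
  have h3 : TensorProduct.comm ℂ W W τ = τ := by
    rw [← sub_eq_zero]
    refine tensor_eq_zero_of_dual _ fun α β => ?_
    have h4 : ∀ t : W ⊗[ℂ] W, TensorProduct.dualDistrib ℂ W W (α ⊗ₜ β)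
        (TensorProduct.comm ℂ W W t) = TensorProduct.dualDistrib ℂ W W (β ⊗ₜ α) t := by
      intro t
      induction t with
      | zero => simp
      | add x y hx hy => simp only [map_add, hx, hy]
      | tmul x y => simp [mul_comm]
    rw [map_sub, h4, dualDistrib_lTensor_gU, dualDistrib_lTensor_gU, sub_eq_zero]
    exact hq.minor β α u u'
  have h5 : ∀ t, Ψ (TensorProduct.comm ℂ W W t) = -Ψ t := by
    intro t
    induction t with
    | zero => simp
    | add x y hx hy => simp only [map_add, hx, hy, neg_add]
    | tmul a b =>
      change orientDual vol b (wedge W (a ⊗ₜ y)) = -orientDual vol a (wedge W (b ⊗ₜ y))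
      rw [orientDual_wedge, orientDual_wedge]
      have := (volForm vol).map_swap ![a, b, y] (i := 0) (j := 1) (by simp)
      rw [← this]
      congr 1
      ext i
      fin_cases i <;> simp [Equiv.swap_apply_def]
  have h6 := h5 τ
  rw [h3] at h6
  exact self_eq_neg.1 h6

/-- The criterion for surjectivity of the contraction, by duality. -/
theorem mainAssumption_of_symmetric [FiniteDimensional ℂ U] [FiniteDimensional ℂ W]
    (B : Dual ℂ U ⊗[ℂ] W ⊗[ℂ] Dual ℂ V)
    (h : ∀ N : Dual ℂ W →ₗ[ℂ] U,
      (∀ v (α β : Dual ℂ W), α (gHom B v (N β)) = β (gHom B v (N α))) → N = 0) :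
    MainAssumption B := by
  rw [MainAssumption, ← LinearMap.range_eq_top]
  by_contra hr
  obtain ⟨f, hf, hfr⟩ := Submodule.exists_le_ker_of_lt_top _ (lt_top_iff_ne_top.2 hr)
  -- A functional on U^∨ ⊗ W^∨ is a map W^∨ → U; vanishing on the image of the contraction means
  -- that all M v ∘ N are symmetric.
  let N : Dual ℂ W →ₗ[ℂ] U := (evalEquiv ℂ U).symm.toLinearMap ∘ₗ (TensorProduct.curry f).flip
  have hN : ∀ φ β, φ (N β) = f (φ ⊗ₜ β) := by
    intro φ β
    change φ ((evalEquiv ℂ U).symm ((TensorProduct.curry f).flip β)) = _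
    rw [apply_evalEquiv_symm_apply]
    rfl
  have h0 := h N fun v α β => by
    have h1 : f (contraction B (wedge _ (α ⊗ₜ β) ⊗ₜ v)) = 0 := hfr ⟨_, rfl⟩
    have h2 : contraction B (wedge _ (α ⊗ₜ β) ⊗ₜ v) =
        (α ∘ₗ gHom B v) ⊗ₜ β - (β ∘ₗ gHom B v) ⊗ₜ α := by
      change LinearMap.rTensor (Dual ℂ W) (gHom B v).dualMap (wedgeIncl _ (wedge _ (α ⊗ₜ β))) = _
      rw [wedgeIncl_wedge, map_sub]
      rfl
    rw [h2, map_sub, ← hN, ← hN, sub_eq_zero] at h1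
    exact h1
  refine hf (TensorProduct.ext' fun φ β => ?_)
  rw [← hN, h0]
  simp

/-! ### The tensor B' and its slices -/

theorem gHom_toBidual {X : Type*} [AddCommGroup X] [Module ℂ X] (C : Dual ℂ X ⊗[ℂ] W ⊗[ℂ] V)
    (ξ : Dual ℂ V) (x : X) (α : Dual ℂ W) :
    α (gHom (toBidual C) ξ x) = TensorProduct.dualDistrib ℂ W V (α ⊗ₜ ξ)
      (dualTensorHom ℂ X (W ⊗[ℂ] V) (TensorProduct.assoc ℂ _ _ _ C) x) := by
  induction C with
  | zero => simp [toBidual, gHom, gV]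
  | add y z hy hz =>
    simp only [map_add, LinearMap.add_apply, ← hy, ← hz]
    simp [toBidual, gHom, gV]
  | tmul s v =>
    induction s with
    | zero => simp [toBidual, gHom, gV]
    | add y z hy hz =>
      rw [TensorProduct.add_tmul]
      simp only [map_add, LinearMap.add_apply, ← hy, ← hz]
      simp [toBidual, gHom, gV]
    | tmul φ w =>
      simp [toBidual, gHom, gV]
      ring

theorem dualTensorHom_crossTensor [FiniteDimensional ℂ W] [FiniteDimensional ℂ V]
    (vol : ⋀[ℂ]^3 W ≃ₗ[ℂ] ℂ) (B : Dual ℂ U ⊗[ℂ] W ⊗[ℂ] Dual ℂ V) :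
    dualTensorHom ℂ (crossSpace vol B) (W ⊗[ℂ] V)
      (TensorProduct.assoc ℂ _ _ _ (crossTensor vol B)) = (crossSpace vol B).subtype := by
  rw [crossTensor, LinearEquiv.apply_symm_apply]
  exact (dualTensorHomEquiv ℂ (crossSpace vol B) (W ⊗[ℂ] V)).apply_symm_apply _

theorem dualTensorHom_map {X : Type*} [AddCommGroup X] [Module ℂ X]
    (B : Dual ℂ U ⊗[ℂ] W ⊗[ℂ] Dual ℂ V) (f : X →ₗ[ℂ] U) (q : Dual ℂ V →ₗ[ℂ] V) :
    dualTensorHom ℂ X (W ⊗[ℂ] V) (TensorProduct.assoc ℂ _ _ _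
      (TensorProduct.map (LinearMap.rTensor W f.dualMap) q B)) =
    LinearMap.lTensor W q ∘ₗ gU B ∘ₗ f := by
  induction B with
  | zero => ext; simp [gU]
  | add y z hy hz =>
    simp only [map_add, hy, hz]
    ext; simp [gU]
  | tmul s ξ =>
    induction s with
    | zero => ext; simp [gU]
    | add y z hy hz =>
      rw [TensorProduct.add_tmul]
      simp only [map_add, hy, hz]
      ext; simp [gU]
    | tmul φ w => ext; simp [gU]

end TriTensor

theorem mainTheorem4 {U W V : Type*}
    [AddCommGroup U] [Module ℂ U] [FiniteDimensional ℂ U]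
    [AddCommGroup W] [Module ℂ W] [FiniteDimensional ℂ W]
    [AddCommGroup V] [Module ℂ V] [FiniteDimensional ℂ V]
    (hU : Module.finrank ℂ U = 3) (hW : Module.finrank ℂ W = 3) (hV : Module.finrank ℂ V = 4)
    (volU : ⋀[ℂ]^3 U ≃ₗ[ℂ] ℂ) (volW : ⋀[ℂ]^3 W ≃ₗ[ℂ] ℂ)
    (B : Module.Dual ℂ U ⊗[ℂ] W ⊗[ℂ] Module.Dual ℂ V)
    (hB : TriTensor.IsSmoothHypersurface (TriTensor.detCubic volU volW B)) :
    TriTensor.MainAssumption B ∧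
    Module.finrank ℂ (TriTensor.crossSpace volW B) = 3 ∧
    TriTensor.MainAssumption (TriTensor.toBidual (TriTensor.crossTensor volW B)) ∧
    Module.finrank ℂ (TriTensor.schurKernel B) = 1 ∧
    ∀ Q ∈ TriTensor.schurKernel B, Q ≠ 0 →
      Function.Bijective (TriTensor.quadricMap Q) ∧
      (LinearMap.range (TriTensor.gU B)).map
        (LinearMap.lTensor W (TriTensor.quadricMap Q)) = TriTensor.crossSpace volW B ∧
      ∃ e : U ≃ₗ[ℂ] TriTensor.crossSpace volW B,
        (∀ u : U, (e u : W ⊗[ℂ] V) =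
          LinearMap.lTensor W (TriTensor.quadricMap Q) (TriTensor.gU B u)) ∧
        TriTensor.crossTensor volW B =
          TensorProduct.map
            (LinearMap.rTensor W (e.symm : TriTensor.crossSpace volW B →ₗ[ℂ] U).dualMap)
            (TriTensor.quadricMap Q) B := by
  open TriTensor Module in
  have hM : IsNondegenerate (gHom B) := isNondegenerate_of_isSmooth hU hW volU volW B hB
  have hmain : MainAssumption B :=
    mainAssumption_of_symmetric B fun N hN => hM.eq_zero_of_symmetric hU hW hV N hN
  have hcross := finrank_crossSpace hU hW hV volW B hmain
  have hK := finrank_schurKernel hU hW hV B hM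
  have hinj : ∀ Q ∈ schurKernel B, Q ≠ 0 → Function.Injective (quadricMap Q) :=
    fun Q hQ hQ0 => (isApolar_quadricMap B hQ).injective hM hU hW hV
      fun hq => hQ0 (quadricMap_injective hq)
  have hbij : ∀ Q ∈ schurKernel B, Q ≠ 0 → Function.Bijective (quadricMap Q) :=
    fun Q hQ hQ0 => ⟨hinj Q hQ hQ0, (LinearMap.injective_iff_surjective_of_finrank_eq_finrank
      (by rw [Subspace.dual_finrank_eq])).1 (hinj Q hQ hQ0)⟩
  have hequiv : ∀ Q ∈ schurKernel B, Q ≠ 0 → ∃ e : U ≃ₗ[ℂ] crossSpace volW B,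
      ∀ u : U, (e u : W ⊗[ℂ] V) = LinearMap.lTensor W (quadricMap Q) (gU B u) := by
    intro Q hQ hQ0
    have hap := isApolar_quadricMap B hQ
    let f : U →ₗ[ℂ] crossSpace volW B :=
      (LinearMap.lTensor W (quadricMap Q) ∘ₗ gU B).codRestrict _
        fun u => lTensor_quadricMap_mem volW B hap u
    have hf : Function.Injective f := by
      rw [← LinearMap.ker_eq_bot, Submodule.eq_bot_iff]
      intro u hu
      by_contra hu0
      have hu1 : LinearMap.lTensor W (quadricMap Q) (gU B u) = 0 := congrArg Subtype.val hu
      have hα : ∀ α : Dual ℂ W, α ∘ₗ (gHom B).flip u = 0 := fun α => by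
        apply hinj Q hQ hQ0
        rw [map_zero]
        refine (forall_dual_apply_eq_zero_iff ℂ _).1 fun β => ?_
        rw [← dualDistrib_lTensor_gU, hu1, map_zero]
      -- With P = ⊤ the block condition just says that u is not killed by every M v.
      obtain ⟨α, -, v, hv⟩ := hM.col_block hU hW hV hu0 ⊤
        (by rw [finrank_top, Subspace.dual_finrank_eq, hW]; norm_num)
      exact hv (LinearMap.congr_fun (hα α) v)
    exact ⟨LinearEquiv.ofInjectiveOfFinrankEq f hf (hU.trans hcross.symm), fun u => rfl⟩
  refine ⟨hmain, hcross, ?_, hK, fun Q hQ hQ0 => ⟨hbij Q hQ hQ0, ?_, ?_⟩⟩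
  · have : Nontrivial (schurKernel B) := nontrivial_of_finrank_pos (R := ℂ) (by omega)
    obtain ⟨⟨Q, hQ⟩, hne⟩ := exists_ne (0 : schurKernel B)
    have hQ0 : Q ≠ 0 := fun h => hne (Subtype.ext h)
    obtain ⟨e, he⟩ := hequiv Q hQ hQ0
    have hap := isApolar_quadricMap B hQ
    -- The slice of B' at ξ is the slice of B at q ξ, up to e. So if N makes the slices of B'
    -- symmetric, e⁻¹ ∘ N does so for B.
    have hkey : ∀ (ξ : Dual ℂ V) (u : U) (α : Dual ℂ W),
        α (gHom (toBidual (crossTensor volW B)) ξ (e u)) = α (gHom B (quadricMap Q ξ) u) := by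
      intro ξ u α
      rw [gHom_toBidual, dualTensorHom_crossTensor, Submodule.subtype_apply, he,
        dualDistrib_lTensor_gU, hap.symm]
      rfl
    refine mainAssumption_of_symmetric _ fun N hN => ?_
    have h0 := hM.eq_zero_of_symmetric hU hW hV (e.symm.toLinearMap ∘ₗ N) fun v α β => by
      obtain ⟨ξ, rfl⟩ := (hbij Q hQ hQ0).2 v
      have := hN ξ α β
      rw [← e.apply_symm_apply (N α), ← e.apply_symm_apply (N β), hkey, hkey] at this
      exact this
    ext1 α
    exact e.symm.map_eq_zero_iff.1 (LinearMap.congr_fun h0 α)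
  · obtain ⟨e, he⟩ := hequiv Q hQ hQ0
    ext t
    constructor
    · rintro ⟨_, ⟨u, rfl⟩, rfl⟩
      rw [← he]
      exact (e u).2
    · intro ht
      refine ⟨_, ⟨e.symm ⟨t, ht⟩, rfl⟩, ?_⟩
      rw [← he, e.apply_symm_apply]
  · obtain ⟨e, he⟩ := hequiv Q hQ hQ0
    refine ⟨e, he, ?_⟩
    -- Both tensors are compared as maps U' → W ⊗ V, where each is the inclusion.
    apply (TensorProduct.assoc ℂ (Dual ℂ (crossSpace volW B)) W V).injective
    apply (dualTensorHomEquiv ℂ (crossSpace volW B) (W ⊗[ℂ] V)).injective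
    refine (dualTensorHom_crossTensor volW B).trans
      (Eq.trans ?_ (dualTensorHom_map B e.symm.toLinearMap (quadricMap Q)).symm)
    ext1 x
    have := he (e.symm x)
    rw [e.apply_symm_apply] at this
    exact this
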